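/- All graphs are finite and simple. An edge-coloring of a graph $G$ is any map from $E(G)$ to the natural numbers, called colors (adjacent edges may receive the same color). An edge-cut of $G$ is a set $F\subseteq E(G)$ such that $G-F$ is not connected; it separates two vertices $u,v$ if $u$ and $v$ lie in different components of $G-F$, and it is monochromatic if all edges of $F$ have the same color. An edge-coloring of $G$ is an MD-coloring if any two distinct vertices of $G$ are separated by a monochromatic edge-cut. For a connected graph $G$, the monochromatic disconnection number $md(G)$ is the maximum number of colors used by an MD-coloring of $G$. Let $\overline{G}$ denote the complement of $G$. **Theorem 4.4 (Nordhaus–Gaddum product bounds).** Let $G$ be a graph on $n\ge 4$ vertices such that both $G$ and $\overline{G}$ are connected. Then - $md(G)\cdot md(\overline{G})=9$ if $n=4$; - $4\le md(G)\cdot md(\overline{G})\le 9$ if $n=5$; - $3\le md(G)\cdot md(\overline{G})\le 10$ if $n=6$; - $1\le md(G)\cdot md(\overline{G})\le 2(n-1)$ if $n\ge 7$. All bounds are sharp: for each $n\ge 4$, each of the lower and upper bounds listed for that $n$ is attained by some graph $G$ on $n$ vertices with $G$ and $\overline{G}$ connected (for $n=4$, such a graph exists). -/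

import Mathlib

namespace SimpleGraph

variable {V : Type*}

/-- `F` is an edge-cut of `G`: a set of edges of `G` whose deletion leaves a graph that is
not connected. -/
def IsEdgeCutSet (G : SimpleGraph V) (F : Set (Sym2 V)) : Prop :=
  F ⊆ G.edgeSet ∧ ¬ (G.deleteEdges F).Connected

/-- `F` is a monochromatic `uv`-cut of `G` for the edge-coloring `Γ` (adjacent edges may share
a color): `F` is an edge-cut, all edges in `F` have one and the same color, and
`F` separates `u` and `v`, that is, `u` and `v` lie in different components of `G - F`. -/
def IsMonochromaticCut (G : SimpleGraph V) (Γ : G.edgeSet → ℕ) (u v : V)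
    (F : Set (Sym2 V)) : Prop :=
  G.IsEdgeCutSet F ∧
    (∃ c : ℕ, ∀ e : G.edgeSet, (e : Sym2 V) ∈ F → Γ e = c) ∧
    ¬ (G.deleteEdges F).Reachable u v

/-- `Γ` is a monochromatic disconnection coloring of `G`: any two distinct vertices are separated
by a monochromatic cut. -/
def IsMDColoring (G : SimpleGraph V) (Γ : G.edgeSet → ℕ) : Prop :=
  ∀ u v : V, u ≠ v → ∃ F : Set (Sym2 V), G.IsMonochromaticCut Γ u v F

/-- The numbers of colors that are used by monochromatic disconnection colorings of `G`. -/
def mdColorCounts (G : SimpleGraph V) : Set ℕ :=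
  {k | ∃ Γ : G.edgeSet → ℕ, G.IsMDColoring Γ ∧ (Set.range Γ).ncard = k}

/-- The monochromatic disconnection number: the maximum number of colors used by a monochromatic
disconnection coloring of `G`. For finite `G` the maximum exists, see `isGreatest_md`. -/
noncomputable def md (G : SimpleGraph V) : ℕ :=
  sSup G.mdColorCounts

/-- On a finite graph `md G` is a true maximum. -/
theorem isGreatest_md [Finite V] (G : SimpleGraph V) : IsGreatest G.mdColorCounts G.md := by
  have hne : G.mdColorCounts.Nonempty := by
    refine ⟨_, fun _ => 0, ?_, rfl⟩
    intro u v huv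
    have hbot : G.deleteEdges G.edgeSet = ⊥ := by
      ext a b
      simp
    have hr : ¬ (G.deleteEdges G.edgeSet).Reachable u v := by
      rw [hbot, reachable_bot]
      exact huv
    exact ⟨G.edgeSet, ⟨subset_rfl, fun h => hr (h.preconnected u v)⟩, ⟨0, fun _ _ => rfl⟩, hr⟩
  have hbdd : BddAbove G.mdColorCounts := by
    refine ⟨Nat.card G.edgeSet, ?_⟩
    rintro k ⟨Γ, -, rfl⟩
    rw [← Set.image_univ, ← Set.ncard_univ]
    exact Set.ncard_image_le (Set.toFinite _)
  exact ⟨Nat.sSup_mem hne hbdd, fun k hk => le_csSup hbdd hk⟩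

end SimpleGraph

/-!
A coloring in which any two vertices are separated by a monochromatic cut is the same thing as an
injective map of the vertices into a Hamming graph that sends edges to edges: the coordinate of a
vertex at a color `c` is its component after the edges of color `c` are deleted, and conversely each
edge gets the coordinate in which its ends differ as its color. So `md G` is the largest number of
directions of such a map (`IsHammingEmbedding.card_le_md`, `exists_isHammingEmbedding`).

Upper bounds count the directions that occur in a growing set of vertices: a vertex with one
neighbor in the set adds at most one direction, a vertex with two neighbors in the set adds none,
and two vertices with three common neighbors lie on a line. Hence `md G ≤ n - 1`. For the product,
the main point is `md_compl_le_three`: if `n ≥ 5` and `G` has at least three directions, then its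
complement has at most three. Vertices that differ in two coordinates are adjacent in the
complement. If a class of some coordinate has at least three vertices and at least two vertices are
outside, then each vertex outside is joined in the complement to all vertices of the class but at
most one, so the complement has few directions (`IsHammingEmbedding.dimLE_compl_of_class`).
Otherwise, two of the coordinates have only classes of size at most two, or two are constant up to
one vertex; these cases are easy. Therefore one of the two numbers is at most two, or both are three.

The lower bounds for `n = 5` and `n = 6` are given by matching cuts, which yield two directions. On
five vertices a graph with connected complement has a matching cut. On six vertices a graph `G` with
`md G = 1` has neither a matching cut nor a cut vertex. If its maximum degree is at most three, this
leaves only `K₃,₃` minus an edge, and its complement, two triangles and a bridge, has three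
directions; otherwise the complement has a leaf, and the case of five vertices applies to the rest.
For `n = 4`, both graphs are trees.

The upper bounds are attained by a star with a subdivided edge (`broom`) and the bull, and the lower
bounds by the pentagon, `K₃,₃` minus an edge and `oneColorGraph`.
-/

namespace SimpleGraph

variable {V : Type*} {ι κ α β : Type*}

/-! ### Colorings and Hamming embeddings -/

/-- A Hamming embedding of `G` with set of directions `ι`: an injective map into the Hamming
graph on `ι → α` (words, adjacent when they differ in exactly one coordinate) that sends edges to
edges and whose image is not contained in any coordinate hyperplane. The map need not be an
induced embedding. -/
structure IsHammingEmbedding (G : SimpleGraph V) (f : V → ι → α) : Prop where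
  injective : Function.Injective f
  adj : ∀ ⦃u v⦄, G.Adj u v → ∃ i, ∀ j, j ≠ i → f u j = f v j
  nonconst : ∀ i, ∃ u v, f u i ≠ f v i

theorem Reachable.apply_eq_of_adj {β : Type*} {G : SimpleGraph V} {g : V → β}
    (h : ∀ u v, G.Adj u v → g u = g v) {u v : V} (huv : G.Reachable u v) : g u = g v := by
  obtain ⟨p⟩ := huv
  induction p with
  | nil => rfl
  | cons hadj _ ih => exact (h _ _ hadj).trans ih

/-- A connected graph has an edge that leaves `A`, if neither `A` nor its complement is empty. -/
theorem Connected.exists_adj_of_mem_of_notMem {G : SimpleGraph V} (hG : G.Connected) {A : Set V}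
    {u v : V} (hu : u ∈ A) (hv : v ∉ A) : ∃ a ∈ A, ∃ b ∉ A, G.Adj a b := by
  by_contra! hcon
  have := (hG.preconnected u v).apply_eq_of_adj (g := fun w => w ∈ A) fun a b hab =>
    propext ⟨fun ha => by_contra fun hb => hcon a ha b hb hab,
      fun hb => by_contra fun ha => hcon b hb a ha hab.symm⟩
  exact hv (this.mp hu)

/-- Coloring each edge by the coordinate in which its ends differ turns a Hamming embedding into
a monochromatic disconnection coloring. -/
theorem IsHammingEmbedding.card_le_md [Finite V] [Fintype ι] {G : SimpleGraph V}
    {f : V → ι → α} (hf : G.IsHammingEmbedding f) (hG : G.Connected) :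
    Fintype.card ι ≤ G.md := by
  classical
  have hdir : ∀ e : G.edgeSet, ∃ i, ∀ j, j ≠ i → ∀ u v, (e : Sym2 V) = s(u, v) →
      f u j = f v j := by
    rintro ⟨e, he⟩
    induction e with
    | _ a b =>
      obtain ⟨i, hi⟩ := hf.adj (G.mem_edgeSet.1 he)
      refine ⟨i, fun j hj u v huv => ?_⟩
      rcases Sym2.eq_iff.1 huv with ⟨rfl, rfl⟩ | ⟨rfl, rfl⟩
      · exact hi j hj
      · exact (hi j hj).symm
  choose dir hdir using hdir
  set Γ : G.edgeSet → ℕ := fun e => (Fintype.equivFin ι (dir e) : ℕ) with hΓ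
  have hmd : G.IsMDColoring Γ := by
    intro u v huv
    obtain ⟨i, hi⟩ : ∃ i, f u i ≠ f v i := by
      by_contra! h
      exact huv (hf.injective (funext h))
    set F : Set (Sym2 V) := {e | ∃ he : e ∈ G.edgeSet, dir ⟨e, he⟩ = i} with hF
    have hsep : ¬ (G.deleteEdges F).Reachable u v := by
      intro hr
      refine hi (hr.apply_eq_of_adj (g := fun w => f w i) fun a b hab => ?_)
      rw [deleteEdges_adj] at hab
      refine hdir ⟨s(a, b), hab.1⟩ i (fun h => hab.2 ⟨hab.1, h.symm⟩) a b rfl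
    refine ⟨F, ⟨fun e he => he.1, fun h => hsep (h.preconnected u v)⟩,
      ⟨Fintype.equivFin ι i, ?_⟩, hsep⟩
    rintro ⟨e, he'⟩ ⟨he, rfl⟩
    rfl
  have hsurj : Function.Surjective dir := by
    intro i
    by_contra! h
    obtain ⟨u, v, huv⟩ := hf.nonconst i
    exact huv ((hG.preconnected u v).apply_eq_of_adj (g := fun w => f w i)
      fun a b hab => hdir ⟨s(a, b), hab⟩ i (h _).symm a b rfl)
  refine (isGreatest_md G).2 ⟨Γ, hmd, ?_⟩
  have : Set.range Γ = Set.range (fun i : ι => (Fintype.equivFin ι i : ℕ)) := by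
    rw [hΓ]
    exact hsurj.range_comp (fun i : ι => (Fintype.equivFin ι i : ℕ))
  rw [this, Set.ncard_eq_toFinset_card', Set.toFinset_range,
    Finset.card_image_of_injective, Finset.card_univ]
  exact Fin.val_injective.comp (Fintype.equivFin ι).injective

/-- A monochromatic disconnection coloring with the maximum number of colors yields a Hamming
embedding: the coordinate of a vertex at a color is its component after the edges of this color
are deleted. -/
theorem exists_isHammingEmbedding [Finite V] {G : SimpleGraph V} (hG : G.Connected) :
    ∃ (ι : Type) (_ : Fintype ι) (f : V → ι → V),
      G.IsHammingEmbedding f ∧ Fintype.card ι = G.md := by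
  classical
  obtain ⟨Γ, hΓ, hcard⟩ := (isGreatest_md G).1
  have hfin : (Set.range Γ).Finite := Set.finite_range Γ
  let _ := hfin.fintype
  let H : ℕ → SimpleGraph V := fun c => G.deleteEdges {e | ∃ he : e ∈ G.edgeSet, Γ ⟨e, he⟩ = c}
  let f : V → Set.range Γ → V := fun v c => ((H c).connectedComponentMk v).out
  have hf : ∀ u v c, f u c = f v c ↔ (H c).Reachable u v := by
    intro u v c
    rw [← ConnectedComponent.eq]
    constructor
    · intro h
      exact (Quot.out_eq _).symm.trans ((congrArg (Quot.mk (H c).Reachable) h).trans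
        (Quot.out_eq _))
    · intro h
      simp only [f, h]
  have hadj : ∀ u v (h : G.Adj u v), ∀ c : Set.range Γ, (c : ℕ) ≠ Γ ⟨s(u, v), h⟩ →
      f u c = f v c := by
    intro u v h c hc
    rw [hf]
    refine Adj.reachable ?_
    rw [deleteEdges_adj]
    exact ⟨h, fun ⟨he, h'⟩ => hc h'.symm⟩
  have hinj : Function.Injective f := by
    intro u v huv
    by_contra hne
    obtain ⟨F, ⟨hFG, -⟩, ⟨c, hc⟩, hsep⟩ := hΓ u v hne
    by_cases hF : F.Nonempty
    · obtain ⟨e, he⟩ := hF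
      have hcr : c ∈ Set.range Γ := ⟨⟨e, hFG he⟩, hc ⟨e, hFG he⟩ he⟩
      have := (hf u v ⟨c, hcr⟩).1 (congrFun huv _)
      have hle : F ⊆ {e | ∃ he : e ∈ G.edgeSet, Γ ⟨e, he⟩ = c} :=
        fun e he => ⟨hFG he, hc ⟨e, hFG he⟩ he⟩
      exact hsep (this.mono (deleteEdges_anti hle))
    · rw [Set.not_nonempty_iff_eq_empty] at hF
      rw [hF, deleteEdges_empty] at hsep
      exact hsep (hG.preconnected u v)
  refine ⟨Set.range Γ, inferInstance, f, ⟨hinj, ?_, ?_⟩, ?_⟩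
  · intro u v h
    exact ⟨⟨_, ⟨s(u, v), h⟩, rfl⟩, fun c hc => hadj u v h c fun h' => hc (Subtype.ext h')⟩
  · rintro ⟨c, ⟨⟨e, he⟩, rfl⟩⟩
    induction e with
    | _ u v =>
      refine ⟨u, v, fun h => he.ne (hinj (funext fun c => ?_))⟩
      by_cases hc : (c : ℕ) = Γ ⟨s(u, v), he⟩
      · rwa [show c = ⟨Γ ⟨s(u, v), he⟩, _⟩ from Subtype.ext hc]
      · exact hadj u v he c hc
  · rw [← hcard, ← Nat.card_coe_set_eq, Nat.card_eq_fintype_card]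

/-! ### Counting the directions of a Hamming embedding -/

/-- The words of the vertices of `S` agree with each other outside of the coordinates in `D`. -/
def AgreeOff (f : V → ι → α) (D : Finset ι) (S : Set V) : Prop :=
  ∀ u ∈ S, ∀ v ∈ S, ∀ i, i ∉ D → f u i = f v i

/-- The words of the vertices of `S` vary in at most `d` coordinates. -/
def DimLE (f : V → ι → α) (S : Set V) (d : ℕ) : Prop :=
  ∃ D : Finset ι, D.card ≤ d ∧ AgreeOff f D S

section DimLE

variable {G : SimpleGraph V} {f : V → ι → α} {S T : Set V} {d e : ℕ} {s t v : V}

theorem DimLE.mono (h : DimLE f S d) (hST : T ⊆ S) (hde : d ≤ e) : DimLE f T e := by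
  obtain ⟨D, hD, h⟩ := h
  exact ⟨D, hD.trans hde, fun u hu v hv => h u (hST hu) v (hST hv)⟩

theorem dimLE_singleton (f : V → ι → α) (v : V) : DimLE f {v} 0 :=
  ⟨∅, le_rfl, by rintro u rfl v rfl i -; rfl⟩

theorem IsHammingEmbedding.card_le_of_dimLE [Fintype ι] (hf : G.IsHammingEmbedding f)
    (h : DimLE f Set.univ d) : Fintype.card ι ≤ d := by
  obtain ⟨D, hD, h⟩ := h
  rw [← Finset.card_univ]
  refine (Finset.card_le_card fun i _ => ?_).trans hD
  by_contra hi
  obtain ⟨u, v, huv⟩ := hf.nonconst i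
  exact huv (h u trivial v trivial i hi)

/-- A vertex with a neighbor in `S` adds at most one direction. -/
theorem IsHammingEmbedding.dimLE_insert (hf : G.IsHammingEmbedding f) (h : DimLE f S d)
    (hs : s ∈ S) (hsv : G.Adj v s) : DimLE f (insert v S) (d + 1) := by
  classical
  obtain ⟨D, hD, h⟩ := h
  obtain ⟨i, hi⟩ := hf.adj hsv
  refine ⟨insert i D, (Finset.card_insert_le _ _).trans (by omega), ?_⟩
  have key : ∀ u ∈ insert v S, ∀ j, j ∉ insert i D → f u j = f s j := by
    rintro u (rfl | hu) j hj <;> rw [Finset.mem_insert, not_or] at hj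
    · exact hi j hj.1
    · exact h u hu s hs j hj.2
  exact fun u hu w hw j hj => (key u hu j hj).trans (key w hw j hj).symm

theorem IsHammingEmbedding.dimLE_pair (hf : G.IsHammingEmbedding f) (h : G.Adj s t) :
    DimLE f {s, t} 1 :=
  hf.dimLE_insert (dimLE_singleton f t) rfl h

/-- Vertices with two neighbors in `S` add no direction: if both edges to `v` have the
same direction, then so has the difference of the two neighbors, and otherwise the two neighbors
differ in both directions. -/
theorem IsHammingEmbedding.dimLE_union (hf : G.IsHammingEmbedding f) (h : DimLE f S d)
    (hT : ∀ v ∈ T, v ∈ S ∨ ∃ s ∈ S, ∃ t ∈ S, s ≠ t ∧ G.Adj v s ∧ G.Adj v t) :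
    DimLE f (S ∪ T) d := by
  obtain ⟨D, hD, h⟩ := h
  refine ⟨D, hD, ?_⟩
  have key : ∀ v ∈ S ∪ T, ∃ s ∈ S, ∀ j, j ∉ D → f v j = f s j := by
    rintro v (hv | hv)
    · exact ⟨v, hv, fun _ _ => rfl⟩
    obtain hv | ⟨s, hs, t, ht, hne, hvs, hvt⟩ := hT v hv
    · exact ⟨v, hv, fun _ _ => rfl⟩
    obtain ⟨i, hi⟩ := hf.adj hvs
    obtain ⟨i', hi'⟩ := hf.adj hvt
    by_cases hii : i = i'
    · subst hii
      refine ⟨s, hs, fun j hj => hi j ?_⟩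
      rintro rfl
      refine hne (hf.injective (funext fun k => ?_))
      by_cases hk : k = j
      · subst hk; exact h s hs t ht k hj
      · exact (hi k hk).symm.trans (hi' k hk)
    · refine ⟨s, hs, fun j hj => ?_⟩
      by_cases hji : j = i
      · rw [hi' j (hji ▸ hii)]
        exact h t ht s hs j hj
      · exact hi j hji
  intro u hu w hw j hj
  obtain ⟨s, hs, hs'⟩ := key u hu
  obtain ⟨t, ht, ht'⟩ := key w hw
  rw [hs' j hj, ht' j hj, h s hs t ht j hj]

theorem IsHammingEmbedding.dimLE_insert_two (hf : G.IsHammingEmbedding f) (h : DimLE f S d)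
    (hs : s ∈ S) (ht : t ∈ S) (hne : s ≠ t) (hvs : G.Adj v s) (hvt : G.Adj v t) :
    DimLE f (insert v S) d := by
  refine (hf.dimLE_union (T := {v}) h ?_).mono (by simp) le_rfl
  rintro w rfl
  exact Or.inr ⟨s, hs, t, ht, hne, hvs, hvt⟩

theorem IsHammingEmbedding.dimLE_univ (hf : G.IsHammingEmbedding f) (h : DimLE f S d)
    (hT : ∀ v, v ∈ S ∨ ∃ s ∈ S, ∃ t ∈ S, s ≠ t ∧ G.Adj v s ∧ G.Adj v t) :
    DimLE f Set.univ d :=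
  (hf.dimLE_union (T := Set.univ) h fun v _ => hT v).mono (by simp) le_rfl

theorem IsHammingEmbedding.dimLE_triangle (hf : G.IsHammingEmbedding f) {a b c : V}
    (hab : G.Adj a b) (hac : G.Adj a c) (hbc : G.Adj b c) : DimLE f {a, b, c} 1 :=
  hf.dimLE_insert_two (hf.dimLE_pair hbc) (by simp) (by simp) hbc.ne hab hac

/-- Two vertices with three common neighbors lie on a line: two words at distance two have only
two common neighbors in a Hamming graph. -/
theorem IsHammingEmbedding.dimLE_of_three_common (hf : G.IsHammingEmbedding f) {a b x y z : V}
    (hab : a ≠ b) (hxy : x ≠ y) (hxz : x ≠ z) (hyz : y ≠ z)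
    (hxa : G.Adj x a) (hxb : G.Adj x b) (hya : G.Adj y a) (hyb : G.Adj y b)
    (hza : G.Adj z a) (hzb : G.Adj z b) : DimLE f {a, b} 1 := by
  classical
  by_contra hD
  -- The two directions of a common neighbor are exactly the coordinates where `a`, `b` differ.
  have key : ∀ w, G.Adj w a → G.Adj w b → ∃ i, (∀ k, k ≠ i → f w k = f a k) ∧ f w i = f b i ∧
      f a i ≠ f b i ∧ ∃ j, ∀ k, f a k ≠ f b k → k = i ∨ k = j := by
    intro w hwa hwb
    obtain ⟨i, hi⟩ := hf.adj hwa
    obtain ⟨j, hj⟩ := hf.adj hwb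
    have hij : i ≠ j := by
      rintro rfl
      refine hD ⟨{i}, by simp, ?_⟩
      have : ∀ k, k ≠ i → f a k = f b k := fun k hk => (hi k hk).symm.trans (hj k hk)
      have hu : ∀ u ∈ ({a, b} : Set V), ∀ k, k ≠ i → f u k = f a k := by
        rintro u (rfl | rfl) k hk
        exacts [rfl, (this k hk).symm]
      intro u h1 v h2 k hk
      rw [Finset.mem_singleton] at hk
      rw [hu u h1 k hk, hu v h2 k hk]
    refine ⟨i, hi, hj i hij, fun h => hwa.ne (hf.injective (funext fun k => ?_)), j, ?_⟩
    · by_cases hk : k = i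
      · subst hk; rw [hj k hij, h]
      · exact hi k hk
    · intro k hk
      by_contra! hk'
      exact hk ((hi k hk'.1).symm.trans (hj k hk'.2))
  have heq : ∀ w w' i, (∀ k, k ≠ i → f w k = f a k) → f w i = f b i →
      (∀ k, k ≠ i → f w' k = f a k) → f w' i = f b i → w = w' := by
    intro w w' i h1 h2 h3 h4
    refine hf.injective (funext fun k => ?_)
    by_cases hk : k = i
    · subst hk; rw [h2, h4]
    · rw [h1 k hk, h3 k hk]
  obtain ⟨i, hi, hi', hi'', j, hj⟩ := key x hxa hxb
  obtain ⟨k, hk, hk', hk'', -⟩ := key y hya hyb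
  obtain ⟨l, hl, hl', hl'', -⟩ := key z hza hzb
  rcases hj k hk'' with rfl | rfl
  · exact hxy (heq _ _ _ hi hi' hk hk')
  rcases hj l hl'' with rfl | rfl
  · exact hxz (heq _ _ _ hi hi' hl hl')
  · exact hyz (heq _ _ _ hk hk' hl hl')

/-- In a connected graph, every vertex outside of `S` adds at most one direction. -/
theorem IsHammingEmbedding.dimLE_univ_of_ncard [Finite V] (hf : G.IsHammingEmbedding f)
    (hG : G.Connected) (h : DimLE f S d) (hS : S.Nonempty) (hc : Sᶜ.ncard ≤ e) :
    DimLE f Set.univ (d + e) := by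
  induction e generalizing S d with
  | zero =>
    rw [Nat.le_zero, Set.ncard_eq_zero, Set.compl_empty_iff] at hc
    exact hc ▸ h
  | succ e ih =>
    by_cases hS' : S = Set.univ
    · exact hS' ▸ h.mono le_rfl (by omega)
    obtain ⟨s, hs⟩ := hS
    obtain ⟨v, hv⟩ := (Set.ne_univ_iff_exists_notMem S).1 hS'
    obtain ⟨s, hs, v, hv, hsv⟩ := hG.exists_adj_of_mem_of_notMem hs hv
    have := ih (hf.dimLE_insert h hs hsv.symm) ⟨v, by simp⟩ (by
      have h1 : (insert v S)ᶜ = Sᶜ \ {v} := by ext; simp [and_comm]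
      rw [h1, Set.ncard_sdiff_singleton_of_mem hv]
      omega)
    exact this.mono le_rfl (by omega)

end DimLE

theorem md_le_card_sub_one [Fintype V] {G : SimpleGraph V} (hG : G.Connected) :
    G.md ≤ Fintype.card V - 1 := by
  obtain ⟨ι, _, f, hf, hcard⟩ := exists_isHammingEmbedding hG
  obtain ⟨v⟩ := hG.nonempty
  rw [← hcard]
  have h := hf.dimLE_univ_of_ncard hG (dimLE_singleton f v) ⟨v, rfl⟩ (e := Fintype.card V - 1) (by
    rw [Set.ncard_compl, Set.ncard_singleton, Nat.card_eq_fintype_card])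
  simpa using hf.card_le_of_dimLE h

theorem one_le_md [Finite V] [Nontrivial V] {G : SimpleGraph V} (hG : G.Connected) :
    1 ≤ G.md := by
  have hf : G.IsHammingEmbedding (fun (v : V) (_ : Unit) => v) :=
    ⟨fun u v h => congrFun h (), fun u v _ => ⟨(), fun j hj => (hj rfl).elim⟩,
      fun _ => exists_pair_ne V⟩
  simpa using hf.card_le_md hG

/-! ### Lower bounds for the monochromatic disconnection number -/

/-- `A` is one side of a matching cut of `G`: a nontrivial bipartition of the vertices where
each vertex has at most one neighbor on the other side. -/
structure IsMatchingCut (G : SimpleGraph V) (A : Set V) : Prop where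
  nonempty : A.Nonempty
  nonempty_compl : Aᶜ.Nonempty
  left : ∀ a ∈ A, ∀ u ∉ A, ∀ v ∉ A, G.Adj a u → G.Adj a v → u = v
  right : ∀ b ∉ A, ∀ u ∈ A, ∀ v ∈ A, G.Adj b u → G.Adj b v → u = v

/-- For a matching cut one coordinate tells the side, and the other one is obtained by
contracting the edges of the cut. -/
theorem IsMatchingCut.two_le_md [Finite V] {G : SimpleGraph V} {A : Set V}
    (hA : G.IsMatchingCut A) (hG : G.Connected) (hV : 3 ≤ Nat.card V) : 2 ≤ G.md := by
  classical
  let r : V → V := fun v => if h : v ∉ A ∧ ∃ a ∈ A, G.Adj v a then h.2.choose else v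
  have hrA : ∀ v ∈ A, r v = v := fun v hv => dif_neg fun h => h.1 hv
  have hradj : ∀ v ∉ A, ∀ a ∈ A, G.Adj v a → r v = a := by
    intro v hv a ha hva
    have h : v ∉ A ∧ ∃ a ∈ A, G.Adj v a := ⟨hv, a, ha, hva⟩
    simp only [r, dif_pos h]
    exact hA.right v hv _ h.2.choose_spec.1 _ ha h.2.choose_spec.2 hva
  have hrB : ∀ v ∉ A, r v ∈ A ∧ G.Adj v (r v) ∨ r v = v := by
    intro v hv
    by_cases h : ∃ a ∈ A, G.Adj v a
    · obtain ⟨a, ha, hva⟩ := h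
      rw [hradj v hv a ha hva]
      exact Or.inl ⟨ha, hva⟩
    · exact Or.inr (dif_neg fun h' => h h'.2)
  have hinj : ∀ u v, (u ∈ A ↔ v ∈ A) → r u = r v → u = v := by
    intro u v huv h
    by_cases hu : u ∈ A
    · rwa [hrA u hu, hrA v (huv.1 hu)] at h
    have hv : v ∉ A := fun hv => hu (huv.2 hv)
    rcases hrB u hu with ⟨hu1, hu2⟩ | hu' <;> rcases hrB v hv with ⟨hv1, hv2⟩ | hv'
    · exact hA.left _ hu1 u hu v hv hu2.symm (h ▸ hv2.symm)
    · exact (hv (hv' ▸ h ▸ hu1)).elim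
    · exact (hu (hu' ▸ h.symm ▸ hv1)).elim
    · rw [← hu', h, hv']
  let f : V → Bool → V ⊕ Prop := fun v i => if i then Sum.inl (r v) else Sum.inr (v ∈ A)
  have hf : G.IsHammingEmbedding f := by
    refine ⟨fun u v h => ?_, fun u v huv => ?_, fun i => ?_⟩
    · have h1 := congrFun h true
      have h2 := congrFun h false
      simp only [f, if_true, Sum.inl.injEq, Bool.false_eq_true, if_false, Sum.inr.injEq] at h1 h2
      exact hinj u v (iff_of_eq h2) h1
    · by_cases h : (u ∈ A ↔ v ∈ A)
      · exact ⟨true, by simp [f, h]⟩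
      · refine ⟨false, ?_⟩
        have : r u = r v := by
          by_cases hu : u ∈ A
          · have hv : v ∉ A := by tauto
            rw [hrA u hu, hradj v hv u hu huv.symm]
          · have hv : v ∈ A := by tauto
            rw [hrA v hv, hradj u hu v hv huv]
        simp [f, this]
    · obtain ⟨a, ha⟩ := hA.nonempty
      obtain ⟨b, hb⟩ := hA.nonempty_compl
      cases i
      · exact ⟨a, b, by simpa [f, ha] using hb⟩
      · have : 2 < Nat.card V := hV
        obtain ⟨c, hca, hcb⟩ : ∃ c, c ≠ a ∧ c ≠ b := by
          by_contra! h
          have : (Set.univ : Set V) ⊆ {a, b} := fun c _ => by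
            by_cases hc : c = a
            · exact Or.inl hc
            · exact Or.inr (h c hc)
          have h1 := Set.ncard_le_ncard this
          rw [Set.ncard_univ] at h1
          have := Set.ncard_insert_le a {b}
          rw [Set.ncard_singleton] at this
          omega
        by_cases hc : c ∈ A
        · exact ⟨c, a, fun h => hca (hinj _ _ (by tauto) (by simpa [f] using h))⟩
        · exact ⟨c, b, fun h => hcb (hinj _ _ (by tauto) (by simpa [f] using h))⟩
  simpa using hf.card_le_md hG

theorem two_le_md_of_leaf [Finite V] {G : SimpleGraph V} (hG : G.Connected)
    (hV : 3 ≤ Nat.card V) {v : V} (hv : ∀ u w, G.Adj v u → G.Adj v w → u = w) : 2 ≤ G.md := by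
  have : Nontrivial V := Finite.one_lt_card_iff_nontrivial.1 (by omega)
  obtain ⟨w, hw⟩ := exists_ne v
  refine IsMatchingCut.two_le_md (A := {v}) ⟨⟨v, rfl⟩, ⟨w, hw⟩, ?_, ?_⟩ hG hV
  · rintro _ rfl u - w - h1 h2
    exact hv u w h1 h2
  · rintro b - _ rfl _ rfl - -
    rfl

/-- The two coordinates contract one side of the cut vertex `v` each to `v`. -/
theorem two_le_md_of_cutVertex [Finite V] {G : SimpleGraph V} (hG : G.Connected) {v : V}
    (hv : ¬ (G.induce {v}ᶜ).Preconnected) : 2 ≤ G.md := by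
  classical
  obtain ⟨⟨a, ha⟩, ⟨b, hb⟩, hab⟩ : ∃ a b, ¬ (G.induce {v}ᶜ).Reachable a b := by
    simpa [Preconnected] using hv
  obtain ⟨A, haA, hvA, hbA, hA⟩ : ∃ A : Set V, a ∈ A ∧ v ∉ A ∧ b ∉ A ∧
      ∀ u w, u ≠ v → w ≠ v → G.Adj u w → u ∈ A → w ∈ A := by
    refine ⟨{w | ∃ h : w ∈ ({v}ᶜ : Set V), (G.induce {v}ᶜ).Reachable ⟨a, ha⟩ ⟨w, h⟩},
      ⟨ha, Reachable.refl _⟩, fun ⟨h, _⟩ => h rfl, fun ⟨_, h⟩ => hab h, ?_⟩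
    rintro u w hu hw huw ⟨_, h⟩
    exact ⟨hw, h.trans (Adj.reachable (by simpa using huw))⟩
  let f : V → Bool → V := fun u i =>
    if i then (if u ∈ A then u else v) else (if u ∈ A then v else u)
  have hf : G.IsHammingEmbedding f := by
    refine ⟨fun u w h => ?_, fun u w huw => ?_, fun i => ?_⟩
    · have h1 := congrFun h true
      have h2 := congrFun h false
      simp only [f, if_true, Bool.false_eq_true, if_false] at h1 h2
      by_cases hu : u ∈ A <;> by_cases hw : w ∈ A <;> simp only [hu, hw, if_true, if_false] at h1 h2
      · exact h1
      · exact (hvA (h1 ▸ hu)).elim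
      · exact (hvA (h1 ▸ hw)).elim
      · exact h2
    · have : (u ∈ A ∨ u = v) ∧ (w ∈ A ∨ w = v) ∨ u ∉ A ∧ w ∉ A := by
        have h1 := hA u w
        have h2 := hA w u
        have h3 := huw.symm
        by_cases hu : u = v
        · subst hu; tauto
        · by_cases hw : w = v
          · subst hw; tauto
          · tauto
      rcases this with ⟨hu, hw⟩ | ⟨hu, hw⟩
      · refine ⟨true, ?_⟩
        have : ∀ x, (x ∈ A ∨ x = v) → f x false = v := by
          rintro x (hx | rfl) <;> simp [f, *]
        simp [this u hu, this w hw]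
      · exact ⟨false, by simp [f, hu, hw]⟩
    · cases i
      · refine ⟨b, v, ?_⟩
        simp only [f, hbA, hvA, if_false, Bool.false_eq_true]
        exact hb
      · refine ⟨a, v, ?_⟩
        simp only [f, haA, hvA, if_true, if_false]
        exact ha
  simpa using hf.card_le_md hG

/-- The edge at a leaf can be given a color of its own. -/
theorem md_add_one_le_of_leaf [Finite V] {G : SimpleGraph V} (hG : G.Connected) {v w : V}
    (hw : G.Adj v w) (hv : ∀ u, G.Adj v u → u = w) (hGv : (G.induce {v}ᶜ).Connected) :
    (G.induce {v}ᶜ).md + 1 ≤ G.md := by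
  classical
  obtain ⟨ι, _, g, hg, hcard⟩ := exists_isHammingEmbedding hGv
  let p : V → ({v}ᶜ : Set V) := fun u => if h : u = v then ⟨w, hw.ne'⟩ else ⟨u, h⟩
  have hpv : p v = ⟨w, hw.ne'⟩ := dif_pos rfl
  have hp : ∀ u (h : u ≠ v), p u = ⟨u, h⟩ := fun u h => dif_neg h
  let f : V → Option ι → ({v}ᶜ : Set V) ⊕ Prop := fun u i =>
    i.elim (Sum.inr (u = v)) (fun j => Sum.inl (g (p u) j))
  have hf : G.IsHammingEmbedding f := by
    refine ⟨fun u x h => ?_, fun u x hux => ?_, fun i => ?_⟩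
    · have h1 : (u = v) = (x = v) := by simpa [f] using congrFun h none
      have h2 : p u = p x := hg.injective (funext fun j => by simpa [f] using congrFun h (some j))
      by_cases hu : u = v
      · rw [hu, h1.mp hu]
      · have hx : x ≠ v := fun hx => hu (h1.mpr hx)
        rw [hp u hu, hp x hx] at h2
        exact congrArg Subtype.val h2
    · by_cases hu : u = v
      · subst hu
        refine ⟨none, fun j hj => ?_⟩
        have hx : x = w := hv x hux
        subst hx
        obtain ⟨j, rfl⟩ := Option.ne_none_iff_exists'.1 hj
        simp [f, hpv, hp x hux.ne']
      by_cases hx : x = v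
      · subst hx
        refine ⟨none, fun j hj => ?_⟩
        have hu : u = w := hv u hux.symm
        subst hu
        obtain ⟨j, rfl⟩ := Option.ne_none_iff_exists'.1 hj
        simp [f, hpv, hp u hux.ne]
      obtain ⟨i, hi⟩ := hg.adj (u := ⟨u, hu⟩) (v := ⟨x, hx⟩) (by simpa using hux)
      refine ⟨some i, fun j hj => ?_⟩
      cases j with
      | none => simp [f, hu, hx]
      | some j =>
        simp only [f, Option.elim, hp u hu, hp x hx]
        rw [hi j (fun h => hj (congrArg some h))]
    · cases i with
      | none => exact ⟨v, w, by simp [f, hw.ne']⟩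
      | some i =>
        obtain ⟨⟨a, ha⟩, ⟨b, hb⟩, hab⟩ := hg.nonconst i
        exact ⟨a, b, by simpa [f, hp a ha, hp b hb] using hab⟩
  have := hf.card_le_md hG
  rwa [Fintype.card_option, hcard] at this

/-- If the vertices are partitioned into `A` and its complement, with just the edge `pq` in
between, then there are a color for this edge and one for each of the two sides. -/
theorem three_le_md_of_bridge [Finite V] {G : SimpleGraph V} (hG : G.Connected) {A : Set V}
    {p p' q q' : V} (hp : p ∈ A) (hp' : p' ∈ A) (hpp : p ≠ p') (hq : q ∉ A) (hq' : q' ∉ A)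
    (hqq : q ≠ q') (h : ∀ u ∈ A, ∀ v ∉ A, G.Adj u v → u = p ∧ v = q) : 3 ≤ G.md := by
  classical
  let f : V → Fin 3 → V := fun u => if u ∈ A then ![p, u, q] else ![q, p, u]
  have hf : G.IsHammingEmbedding f := by
    refine ⟨fun u v huv => ?_, ?_, fun i => ?_⟩
    · have h0 := congrFun huv 0
      have h1 := congrFun huv 1
      have h2 := congrFun huv 2
      by_cases hu : u ∈ A <;> by_cases hv : v ∈ A <;> simp [f, hu, hv] at h0 h1 h2
      · exact h1
      · exact (hq (h0 ▸ hp)).elim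
      · exact (hq (h0 ▸ hp)).elim
      · exact h2
    · have hcross : ∀ u ∈ A, ∀ v ∉ A, G.Adj u v → ∀ j, j ≠ 0 → f u j = f v j := by
        intro u hu v hv huv j hj
        obtain ⟨rfl, rfl⟩ := h u hu v hv huv
        fin_cases j <;> simp_all [f]
      intro u v huv
      by_cases hu : u ∈ A <;> by_cases hv : v ∈ A
      · exact ⟨1, fun j hj => by fin_cases j <;> simp_all [f]⟩
      · exact ⟨0, hcross u hu v hv huv⟩
      · exact ⟨0, fun j hj => (hcross v hv u hu huv.symm j hj).symm⟩
      · exact ⟨2, fun j hj => by fin_cases j <;> simp_all [f]⟩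
    · have hpq : p ≠ q := fun h => hq (h ▸ hp)
      fin_cases i
      · exact ⟨p, q, by simp [f, hp, hq, hpq]⟩
      · exact ⟨p, p', by simp [f, hp, hp', hpp]⟩
      · exact ⟨q, q', by simp [f, hq, hq', hqq]⟩
  simpa using hf.card_le_md hG

/-- In a tree every edge is a cut, so the edges can have distinct colors. -/
theorem IsTree.card_sub_one_le_md [Fintype V] {G : SimpleGraph V} (hG : G.IsTree) :
    Fintype.card V - 1 ≤ G.md := by
  classical
  obtain ⟨e⟩ : Nonempty (G.edgeSet ≃ Fin (Fintype.card G.edgeSet)) := ⟨Fintype.equivFin _⟩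
  refine (isGreatest_md G).2 ⟨fun x => (e x : ℕ), ?_, ?_⟩
  · intro u v huv
    obtain ⟨p, hp⟩ := (hG.connected.preconnected u v).exists_isPath
    cases p with
    | nil => exact (huv rfl).elim
    | @cons _ w _ huw p =>
      rw [Walk.cons_isPath_iff] at hp
      have hbr := isAcyclic_iff_forall_isBridge.1 hG.isAcyclic (G.mem_edgeSet.2 huw)
      rw [isBridge_iff] at hbr
      have hpe : s(u, w) ∉ p.edges := fun h => hp.2 (p.fst_mem_support_of_mem_edges h)
      have hwv : (G.deleteEdges {s(u, w)}).Reachable w v :=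
        ⟨p.toDeleteEdge _ hpe⟩
      have hsep : ¬ (G.deleteEdges {s(u, w)}).Reachable u v :=
        fun h => hbr (h.trans hwv.symm)
      refine ⟨{s(u, w)}, ⟨by simpa using huw, fun h => hsep (h.preconnected u v)⟩,
        ⟨e ⟨s(u, w), huw⟩, ?_⟩, hsep⟩
      rintro ⟨x, hx⟩ rfl
      rfl
  · have h1 : Function.Injective fun x => (e x : ℕ) := Fin.val_injective.comp e.injective
    rw [← Set.image_univ, Set.ncard_image_of_injective _ h1, Set.ncard_univ,
      Nat.card_eq_fintype_card, ← edgeFinset_card]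
    have := hG.card_edgeFinset
    omega

/-! ### A graph with three directions and its complement -/

section Complement

variable {G : SimpleGraph V} {f : V → ι → α} {g : V → κ → β}

theorem compl_adj_of_not_adj {u v : V} (h : u ≠ v) (h' : ¬ G.Adj u v) : Gᶜ.Adj u v :=
  (compl_adj G u v).2 ⟨h, h'⟩

theorem adj_of_not_compl_adj {u v : V} (h : u ≠ v) (h' : ¬ Gᶜ.Adj u v) : G.Adj u v := by
  rw [compl_adj] at h'
  tauto

theorem IsHammingEmbedding.compl_adj_of_ne_of_ne (hf : G.IsHammingEmbedding f) {u v : V} {i j : ι}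
    (hij : i ≠ j) (hi : f u i ≠ f v i) (hj : f u j ≠ f v j) : Gᶜ.Adj u v := by
  refine compl_adj_of_not_adj (fun h => hi (h ▸ rfl)) fun h => ?_
  obtain ⟨k, hk⟩ := hf.adj h
  by_cases hik : i = k
  · exact hj (hk j fun h => hij (hik.trans h.symm))
  · exact hi (hk i hik)

theorem IsHammingEmbedding.eq_off (hf : G.IsHammingEmbedding f) {u v : V} {i : ι}
    (h : G.Adj u v) (hi : f u i ≠ f v i) : ∀ j, j ≠ i → f u j = f v j := by
  obtain ⟨k, hk⟩ := hf.adj h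
  have : i = k := by_contra fun h => hi (hk i h)
  exact this ▸ hk

theorem IsHammingEmbedding.ne_of_eq_off (hf : G.IsHammingEmbedding f) {u v : V} {i : ι}
    (h : u ≠ v) (hi : ∀ j, j ≠ i → f u j = f v j) : f u i ≠ f v i := by
  intro h'
  refine h (hf.injective (funext fun j => ?_))
  by_cases hj : j = i
  · exact hj ▸ h'
  · exact hi j hj

/-- Outside of a class of the coordinate `i`, each vertex has at most one neighbor in it. -/
theorem IsHammingEmbedding.eq_of_adj_of_adj (hf : G.IsHammingEmbedding f) {a a' b : V} {i : ι}
    (haa : f a i = f a' i) (hb : f b i ≠ f a i) (h : G.Adj b a) (h' : G.Adj b a') : a = a' := by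
  refine hf.injective (funext fun j => ?_)
  by_cases hj : j = i
  · exact hj ▸ haa
  · rw [← hf.eq_off h hb j hj, ← hf.eq_off h' (haa ▸ hb) j hj]

/-- If `u` and `v` differ just in the coordinate `e`, then a vertex that differs from them in
another coordinate cannot be adjacent to both. -/
theorem IsHammingEmbedding.compl_adj_or (hf : G.IsHammingEmbedding f) {u v w : V} {e k : ι}
    (huv : u ≠ v) (he : ∀ j, j ≠ e → f u j = f v j) (hk : k ≠ e) (hw : f w k ≠ f u k) :
    Gᶜ.Adj w u ∨ Gᶜ.Adj w v := by
  have hne := hf.ne_of_eq_off huv he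
  by_cases h : f w e = f u e
  · exact Or.inr (hf.compl_adj_of_ne_of_ne hk (by rwa [← he k hk]) (by rwa [h]))
  · exact Or.inl (hf.compl_adj_of_ne_of_ne hk hw h)

theorem exists_two_of_three {P : V → Prop} {S : Set V} {x y z : V} (hx : x ∈ S) (hy : y ∈ S)
    (hz : z ∈ S) (hxy : x ≠ y) (hxz : x ≠ z) (hyz : y ≠ z) (h1 : ¬ P x → ¬ P y → False)
    (h2 : ¬ P x → ¬ P z → False) (h3 : ¬ P y → ¬ P z → False) :
    ∃ s ∈ S, ∃ t ∈ S, s ≠ t ∧ P s ∧ P t := by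
  by_cases h : P x
  · by_cases h' : P y
    · exact ⟨x, hx, y, hy, hxy, h, h'⟩
    · exact ⟨x, hx, z, hz, hxz, h, by_contra fun h => h3 h' h⟩
  · exact ⟨y, hy, z, hz, hyz, by_contra fun h' => h1 h h', by_contra fun h' => h2 h h'⟩

variable [Fintype V]

theorem IsHammingEmbedding.dimLE_univ_of_subset (hg : G.IsHammingEmbedding g)
    (hG : G.Connected) {S T : Set V} {d e m : ℕ} (h : DimLE g S d) (hS : S.Nonempty)
    (hT : ∀ v, v ∉ S → v ∈ T) (hc : T.ncard ≤ e) (hm : d + e ≤ m) : DimLE g Set.univ m :=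
  (hg.dimLE_univ_of_ncard hG h hS ((Set.ncard_le_ncard hT).trans hc)).mono le_rfl hm

/-- Let `A` be a class of a coordinate with two vertices outside. If two such vertices have in
the complement all of `A` but possibly one vertex `a₁` as common neighbors, then the complement
has at most three directions. -/
theorem IsHammingEmbedding.dimLE_compl_of_common (hf : G.IsHammingEmbedding f)
    (hg : Gᶜ.IsHammingEmbedding g) (hG : Gᶜ.Connected) {i : ι} {c : α} {A : Finset V}
    (hA : ∀ u, u ∈ A ↔ f u i = c) (hcard : 3 ≤ A.card) {b₁ b₂ a₁ : V} (hb : b₁ ≠ b₂)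
    (hb₁ : b₁ ∉ A) (hb₂ : b₂ ∉ A) (ha₁ : a₁ ∈ A)
    (h : ∀ a ∈ A, a ≠ a₁ → Gᶜ.Adj b₁ a ∧ Gᶜ.Adj b₂ a) : DimLE g Set.univ 3 := by
  classical
  have hne : ∀ {a b}, a ∈ A → b ∉ A → b ≠ a := fun ha hb h => hb (h ▸ ha)
  have hmiss : ∀ b ∉ A, ∀ a ∈ A, ∀ a' ∈ A, a ≠ a' → ¬ Gᶜ.Adj b a → ¬ Gᶜ.Adj b a' → False := by
    intro b hb a ha a' ha' haa h1 h2
    refine haa (hf.eq_of_adj_of_adj (i := i) ?_ ?_ (adj_of_not_compl_adj (hne ha hb) h1)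
      (adj_of_not_compl_adj (hne ha' hb) h2))
    · rw [(hA a).1 ha, (hA a').1 ha']
    · rw [(hA a).1 ha]
      exact fun h => hb ((hA b).2 h)
  have hcard' : 2 ≤ (A.erase a₁).card := by rw [Finset.card_erase_of_mem ha₁]; omega
  rcases hcard'.lt_or_eq with h3 | h2
  · -- With three common neighbors, `b₁` and `b₂` lie on a line.
    obtain ⟨x, y, z, hx, hy, hz, hxy, hxz, hyz⟩ := Finset.two_lt_card_iff.1 h3
    have hx' := h x (Finset.mem_of_mem_erase hx) (Finset.ne_of_mem_erase hx)
    have hy' := h y (Finset.mem_of_mem_erase hy) (Finset.ne_of_mem_erase hy)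
    have hz' := h z (Finset.mem_of_mem_erase hz) (Finset.ne_of_mem_erase hz)
    have h1 : DimLE g {b₁, b₂} 1 := hg.dimLE_of_three_common hb hxy hxz hyz hx'.1.symm
      hx'.2.symm hy'.1.symm hy'.2.symm hz'.1.symm hz'.2.symm
    have h2 := hg.dimLE_union (T := (A.erase a₁ : Finset V)) h1 fun a ha => by
      have := h a (Finset.mem_of_mem_erase ha) (Finset.ne_of_mem_erase ha)
      exact Or.inr ⟨b₁, by simp, b₂, by simp, hb, this.1.symm, this.2.symm⟩
    have h3 := hg.dimLE_union (T := {a₁}ᶜ) h2 fun v hv => by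
      by_cases hvA : v ∈ A
      · exact Or.inl (Or.inr (Finset.mem_coe.2 (Finset.mem_erase.2 ⟨hv, hvA⟩)))
      · have hm := hmiss v hvA
        have e : ∀ {u}, u ∈ A.erase a₁ → u ∈ A := Finset.mem_of_mem_erase
        exact Or.inr (exists_two_of_three (Or.inr hx) (Or.inr hy) (Or.inr hz) hxy hxz hyz
          (hm x (e hx) y (e hy) hxy) (hm x (e hx) z (e hz) hxz) (hm y (e hy) z (e hz) hyz))
    refine hg.dimLE_univ_of_subset hG (T := {a₁}) h3 ⟨b₁, by simp⟩ (fun v hv => ?_)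
      (Set.ncard_singleton _).le (by norm_num)
    by_contra hv'
    exact hv (Or.inr hv')
  · obtain ⟨a₂, a₃, ha, hAe⟩ := Finset.card_eq_two.1 h2.symm
    have ha₂ : a₂ ∈ A.erase a₁ := by simp [hAe]
    have ha₃ : a₃ ∈ A.erase a₁ := by simp [hAe]
    have hAmem : ∀ a ∈ A, a = a₁ ∨ a = a₂ ∨ a = a₃ := by
      intro a ha
      by_cases h : a = a₁
      · exact Or.inl h
      · have : a ∈ A.erase a₁ := Finset.mem_erase.2 ⟨h, ha⟩
        rw [hAe] at this
        simpa [h] using this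
    rw [Finset.mem_erase] at ha₂ ha₃
    obtain ⟨h21, h22⟩ := h a₂ ha₂.2 ha₂.1
    obtain ⟨h31, h32⟩ := h a₃ ha₃.2 ha₃.1
    have hS : DimLE g {b₂, a₃, b₁, a₂} 2 :=
      hg.dimLE_insert_two (hg.dimLE_insert (hg.dimLE_pair h21) (s := b₁) (by simp) h31.symm)
        (s := a₂) (t := a₃) (by simp) (by simp) ha h22 h32
    have hfull : ∀ s ∈ ({b₂, a₃, b₁, a₂} : Set V), Gᶜ.Adj a₁ s → DimLE g Set.univ 3 := by
      intro s hs hadj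
      refine hg.dimLE_univ (hg.dimLE_insert hS hs hadj) fun v => ?_
      by_cases hv : v ∈ A
      · rcases hAmem v hv with rfl | rfl | rfl <;> simp
      · have hm := hmiss v hv
        exact Or.inr (exists_two_of_three (x := a₁) (y := a₂) (z := a₃) (by simp) (by simp)
          (by simp) ha₂.1.symm ha₃.1.symm ha (hm _ ha₁ _ ha₂.2 ha₂.1.symm)
          (hm _ ha₁ _ ha₃.2 ha₃.1.symm) (hm _ ha₂.2 _ ha₃.2 ha))
    by_cases hb1 : Gᶜ.Adj b₁ a₁
    · exact hfull b₁ (by simp) hb1.symm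
    by_cases hb2 : Gᶜ.Adj b₂ a₁
    · exact hfull b₂ (by simp) hb2.symm
    -- Now `b₁`, `b₂` and `a₁` are on a common line of `G`, and a vertex outside of `A` on the
    -- line of another vertex of `A` differs from one of `b₁`, `b₂` in two coordinates.
    have hoff : ∀ b ∉ A, ∀ a ∈ A, ¬ Gᶜ.Adj b a → ∀ j, j ≠ i → f b j = f a j := by
      intro b hb a ha h
      refine hf.eq_off (adj_of_not_compl_adj (hne ha hb) h) ?_
      rw [(hA a).1 ha]
      exact fun h => hb ((hA b).2 h)
    have hoff1 := hoff b₁ hb₁ a₁ ha₁ hb1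
    have hoff2 := hoff b₂ hb₂ a₁ ha₁ hb2
    have hbi := hf.ne_of_eq_off hb (i := i) fun j hj => (hoff1 j hj).trans (hoff2 j hj).symm
    have hother : ∀ b ∉ A, ∀ a ∈ A, a ≠ a₁ → ¬ Gᶜ.Adj b a → Gᶜ.Adj b b₁ ∨ Gᶜ.Adj b b₂ := by
      intro b hb a ha haa hba
      obtain ⟨j, hj⟩ : ∃ j, f a j ≠ f a₁ j := by
        by_contra! h
        exact haa (hf.injective (funext h))
      have hji : j ≠ i := by
        rintro rfl
        exact hj (by rw [(hA a).1 ha, (hA a₁).1 ha₁])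
      rw [← hoff b hb a ha hba j hji] at hj
      by_cases h1 : f b i = f b₁ i
      · exact Or.inr (hf.compl_adj_of_ne_of_ne hji (by rwa [hoff2 j hji]) (by rwa [h1]))
      · exact Or.inl (hf.compl_adj_of_ne_of_ne hji (by rwa [hoff1 j hji]) h1)
    have hT := hg.dimLE_union (T := {v | v ∉ A}) hS fun v hv => by
      by_cases h2 : Gᶜ.Adj v a₂
      · by_cases h3 : Gᶜ.Adj v a₃
        · exact Or.inr ⟨a₂, by simp, a₃, by simp, ha, h2, h3⟩
        · rcases hother v hv a₃ ha₃.2 ha₃.1 h3 with h | h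
          · exact Or.inr ⟨a₂, by simp, b₁, by simp, h21.ne', h2, h⟩
          · exact Or.inr ⟨a₂, by simp, b₂, by simp, h22.ne', h2, h⟩
      · have h3 : Gᶜ.Adj v a₃ := by_contra fun h3 => hmiss v hv _ ha₂.2 _ ha₃.2 ha h2 h3
        rcases hother v hv a₂ ha₂.2 ha₂.1 h2 with h | h
        · exact Or.inr ⟨a₃, by simp, b₁, by simp, h31.ne', h3, h⟩
        · exact Or.inr ⟨a₃, by simp, b₂, by simp, h32.ne', h3, h⟩
    refine hg.dimLE_univ_of_subset hG (T := {a₁}) hT ⟨b₁, by simp⟩ (fun v hv => ?_)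
      (Set.ncard_singleton _).le (by norm_num)
    by_contra hv'
    refine hv ?_
    by_cases hvA : v ∈ A
    · rcases hAmem v hvA with rfl | rfl | rfl
      · exact (hv' rfl).elim
      · simp
      · simp
    · exact Or.inr hvA

/-- A coordinate that has a class with at least three vertices inside and at least two vertices
outside forces the complement to have at most three directions. -/
theorem IsHammingEmbedding.dimLE_compl_of_class [Fintype ι] (hf : G.IsHammingEmbedding f)
    (hg : Gᶜ.IsHammingEmbedding g) (hG : Gᶜ.Connected) (hι : 3 ≤ Fintype.card ι) {i : ι} {c : α}
    {A : Finset V} (hA : ∀ u, u ∈ A ↔ f u i = c) (hcard : 3 ≤ A.card) {b₁ b₂ : V}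
    (hb : b₁ ≠ b₂) (hb₁ : b₁ ∉ A) (hb₂ : b₂ ∉ A) : DimLE g Set.univ 3 := by
  classical
  by_cases hcom : ∃ b₁ ∉ A, ∃ b₂ ∉ A, b₁ ≠ b₂ ∧ ∃ a₁ ∈ A, ∀ a ∈ A, a ≠ a₁ →
      Gᶜ.Adj b₁ a ∧ Gᶜ.Adj b₂ a
  · obtain ⟨b₁, hb₁, b₂, hb₂, hb, a₁, ha₁, h⟩ := hcom
    exact hf.dimLE_compl_of_common hg hG hA hcard hb hb₁ hb₂ ha₁ h
  have hne : ∀ {a b}, a ∈ A → b ∉ A → b ≠ a := fun ha hb h => hb (h ▸ ha)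
  have hi : ∀ {a b}, a ∈ A → b ∉ A → f b i ≠ f a i := by
    intro a b ha hb
    rw [(hA a).1 ha]
    exact fun h => hb ((hA b).2 h)
  have hAi : ∀ {a a'}, a ∈ A → a' ∈ A → f a i = f a' i := by
    intro a a' ha ha'
    rw [(hA a).1 ha, (hA a').1 ha']
  have hmiss : ∀ {b a a'}, b ∉ A → a ∈ A → a' ∈ A → G.Adj b a → a ≠ a' → Gᶜ.Adj b a' := by
    intro b a a' hb ha ha' h haa
    exact compl_adj_of_not_adj (hne ha' hb) fun h' =>
      haa (hf.eq_of_adj_of_adj (hAi ha ha') (hi ha hb) h h')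
  -- Each vertex outside of `A` has exactly one neighbor in `A`, and these are distinct.
  have hinj : ∀ {b b' a}, b ∉ A → b' ∉ A → a ∈ A → G.Adj b a → G.Adj b' a → b = b' := by
    intro b b' a hb hb' ha h h'
    by_contra hbb
    exact hcom ⟨b, hb, b', hb', hbb, a, ha, fun a' ha' haa =>
      ⟨hmiss hb ha ha' h haa.symm, hmiss hb' ha ha' h' haa.symm⟩⟩
  have hex : ∀ {b}, b ∉ A → ∃ a ∈ A, G.Adj b a := by
    intro b hb
    by_contra! h
    have h' : ∀ a ∈ A, Gᶜ.Adj b a := fun a ha => compl_adj_of_not_adj (hne ha hb) (h a ha)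
    obtain ⟨b', hb', hbb⟩ : ∃ b', b' ∉ A ∧ b ≠ b' := by
      by_cases h : b = b₁
      · exact ⟨b₂, hb₂, h ▸ ‹b₁ ≠ b₂›⟩
      · exact ⟨b₁, hb₁, h⟩
    by_cases hb'a : ∃ a ∈ A, G.Adj b' a
    · obtain ⟨a, ha, hba⟩ := hb'a
      exact hcom ⟨b, hb, b', hb', hbb, a, ha, fun a' ha' haa =>
        ⟨h' a' ha', hmiss hb' ha ha' hba haa.symm⟩⟩
    · push Not at hb'a
      obtain ⟨a, ha⟩ : A.Nonempty := Finset.card_pos.1 (by omega)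
      exact hcom ⟨b, hb, b', hb', hbb, a, ha, fun a' ha' _ =>
        ⟨h' a' ha', compl_adj_of_not_adj (hne ha' hb') (hb'a a' ha')⟩⟩
  have htwo : ∀ {S : Set V} {x y z v}, v ∉ A → x ∈ A → y ∈ A → z ∈ A → x ≠ y → x ≠ z → y ≠ z →
      x ∈ S → y ∈ S → z ∈ S → ∃ s ∈ S, ∃ t ∈ S, s ≠ t ∧ Gᶜ.Adj v s ∧ Gᶜ.Adj v t := by
    intro S x y z v hv hx hy hz hxy hxz hyz hxS hyS hzS
    have key : ∀ {a a'}, a ∈ A → a' ∈ A → a ≠ a' → ¬ Gᶜ.Adj v a → ¬ Gᶜ.Adj v a' → False :=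
      fun ha ha' haa h h' => h' (hmiss hv ha ha' (adj_of_not_compl_adj (hne ha hv) h) haa)
    exact exists_two_of_three hxS hyS hzS hxy hxz hyz (key hx hy hxy) (key hx hz hxz)
      (key hy hz hyz)
  obtain ⟨m₁, hm₁, hbm₁⟩ := hex hb₁
  obtain ⟨m₂, hm₂, hbm₂⟩ := hex hb₂
  have hm : m₁ ≠ m₂ := fun h => hb (hinj hb₁ hb₂ hm₁ hbm₁ (h ▸ hbm₂))
  have h12 := hmiss hb₁ hm₁ hm₂ hbm₁ hm
  have h21 := hmiss hb₂ hm₂ hm₁ hbm₂ hm.symm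
  set A' := (A.erase m₁).erase m₂ with hA'
  have hA'mem : ∀ {a}, a ∈ A' ↔ a ≠ m₂ ∧ a ≠ m₁ ∧ a ∈ A := by simp [A']
  have hA'1 : ∀ {a}, a ∈ A' → Gᶜ.Adj b₁ a := fun ha =>
    hmiss hb₁ hm₁ (hA'mem.1 ha).2.2 hbm₁ (hA'mem.1 ha).2.1.symm
  have hA'2 : ∀ {a}, a ∈ A' → Gᶜ.Adj b₂ a := fun ha =>
    hmiss hb₂ hm₂ (hA'mem.1 ha).2.2 hbm₂ (hA'mem.1 ha).1.symm
  have hA'card : A'.card + 2 = A.card := by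
    rw [hA', Finset.card_erase_of_mem (Finset.mem_erase.2 ⟨hm.symm, hm₂⟩),
      Finset.card_erase_of_mem hm₁]
    omega
  have hunion : ∀ {S : Set V} {d}, DimLE g S d → b₁ ∈ S → b₂ ∈ S →
      DimLE g (S ∪ (A' : Finset V)) d := fun hS h1 h2 =>
    hg.dimLE_union hS fun a ha => Or.inr ⟨b₁, h1, b₂, h2, hb, (hA'1 ha).symm, (hA'2 ha).symm⟩
  have hpair : ({m₁, m₂} : Set V).ncard ≤ 2 := (Set.ncard_pair hm).le
  by_cases h3 : 2 < A'.card
  · -- With three common neighbors, `b₁` and `b₂` lie on a line.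
    obtain ⟨x, y, z, hx, hy, hz, hxy, hxz, hyz⟩ := Finset.two_lt_card_iff.1 h3
    have h1 : DimLE g {b₁, b₂} 1 := hg.dimLE_of_three_common hb hxy hxz hyz (hA'1 hx).symm
      (hA'2 hx).symm (hA'1 hy).symm (hA'2 hy).symm (hA'1 hz).symm (hA'2 hz).symm
    have h2 := hg.dimLE_union (T := {v | v ∉ A}) (hunion h1 (by simp) (by simp)) fun v hv =>
      Or.inr (htwo hv (hA'mem.1 hx).2.2 (hA'mem.1 hy).2.2 (hA'mem.1 hz).2.2 hxy hxz hyz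
        (Or.inr hx) (Or.inr hy) (Or.inr hz))
    refine hg.dimLE_univ_of_subset hG (T := {m₁, m₂}) h2 ⟨b₁, by simp⟩ (fun v hv => ?_) hpair
      le_rfl
    by_contra hv'
    rw [Set.mem_insert_iff, Set.mem_singleton_iff, not_or] at hv'
    by_cases hvA : v ∈ A
    · exact hv (Or.inl (Or.inr (Finset.mem_coe.2 (hA'mem.2 ⟨hv'.2, hv'.1, hvA⟩))))
    · exact hv (Or.inr hvA)
  obtain ⟨x, hx⟩ : A'.Nonempty := Finset.card_pos.1 (by omega)
  have hxA := (hA'mem.1 hx).2.2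
  by_cases hb₃ : ∃ b₃, b₃ ∉ A ∧ b₃ ≠ b₁ ∧ b₃ ≠ b₂
  · obtain ⟨b₃, hb₃, h31, h32⟩ := hb₃
    obtain ⟨m₃, hm₃, hbm₃⟩ := hex hb₃
    have hm13 : m₁ ≠ m₃ := fun h => h31 (hinj hb₃ hb₁ hm₃ hbm₃ (h ▸ hbm₁))
    have hm23 : m₂ ≠ m₃ := fun h => h32 (hinj hb₃ hb₂ hm₃ hbm₃ (h ▸ hbm₂))
    have hm₃' : m₃ ∈ A' := hA'mem.2 ⟨hm23.symm, hm13.symm, hm₃⟩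
    have h31' := hmiss hb₃ hm₃ hm₁ hbm₃ hm13.symm
    have h32' := hmiss hb₃ hm₃ hm₂ hbm₃ hm23.symm
    by_cases hcard' : 1 < A'.card
    · obtain ⟨y, hy, hym⟩ := Finset.exists_mem_ne hcard' m₃
      have h3y := hmiss hb₃ hm₃ (hA'mem.1 hy).2.2 hbm₃ hym.symm
      have h1 : DimLE g {b₂, b₁, y} 2 :=
        hg.dimLE_insert (hg.dimLE_pair (hA'1 hy)) (s := y) (by simp) (hA'2 hy)
      have h2 := hg.dimLE_insert (hunion h1 (by simp) (by simp)) (s := y) (by simp) h3y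
      have h3 := hg.dimLE_insert_two h2 (v := m₁) (s := b₂) (t := b₃) (by simp) (by simp)
        h32.symm h21.symm h31'.symm
      have h4 := hg.dimLE_insert_two h3 (v := m₂) (s := b₁) (t := b₃) (by simp) (by simp)
        h31.symm h12.symm h32'.symm
      refine hg.dimLE_univ h4 fun v => ?_
      by_cases hv : v ∈ A
      · by_cases h : v ∈ A'
        · exact Or.inl (by simp [h])
        · have : v = m₂ ∨ v = m₁ := by
            rw [hA'mem] at h
            tauto
          rcases this with rfl | rfl <;> simp
      · exact Or.inr (htwo hv hm₁ hm₂ hm₃ hm hm13 hm23 (by simp) (by simp) (by simp [hm₃']))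
    · -- Here `A` consists of `m₁`, `m₂`, `m₃`.
      have hAm : ∀ a ∈ A, a = m₁ ∨ a = m₂ ∨ a = m₃ := by
        intro a ha
        by_contra! h
        exact hcard' (Finset.one_lt_card.2 ⟨a, hA'mem.2 ⟨h.2.1, h.1, ha⟩, m₃, hm₃', h.2.2⟩)
      have hBm : ∀ b, b ∉ A → b = b₁ ∨ b = b₂ ∨ b = b₃ := by
        intro b hb
        obtain ⟨a, ha, hba⟩ := hex hb
        rcases hAm a ha with rfl | rfl | rfl
        · exact Or.inl (hinj hb hb₁ ha hba hbm₁)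
        · exact Or.inr (Or.inl (hinj hb hb₂ ha hba hbm₂))
        · exact Or.inr (Or.inr (hinj hb hb₃ ha hba hbm₃))
      have key : ∀ b₁ b₂ b₃ m₁ m₂ m₃ : V, b₁ ∉ A → b₂ ∉ A → b₃ ∉ A → m₁ ∈ A → m₂ ∈ A →
          m₃ ∈ A → G.Adj b₁ m₁ → G.Adj b₂ m₂ → G.Adj b₃ m₃ → b₁ ≠ b₃ → b₂ ≠ b₃ → m₁ ≠ m₂ →
          m₁ ≠ m₃ → m₂ ≠ m₃ → (∀ a ∈ A, a = m₁ ∨ a = m₂ ∨ a = m₃) → Gᶜ.Adj b₁ b₂ →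
          DimLE g Set.univ 3 := by
        intro b₁ b₂ b₃ m₁ m₂ m₃ hb₁ hb₂ hb₃ hm₁ hm₂ hm₃ h1 h2 h3 hb13 hb23 hm12 hm13 hm23 hAm hbb
        have k1 := hg.dimLE_triangle hbb (hmiss hb₁ hm₁ hm₃ h1 hm13) (hmiss hb₂ hm₂ hm₃ h2 hm23)
        have k2 := hg.dimLE_insert k1 (v := m₁) (s := b₂) (by simp)
          (hmiss hb₂ hm₂ hm₁ h2 hm12.symm).symm
        have k3 := hg.dimLE_insert k2 (v := b₃) (s := m₁) (by simp)
          (hmiss hb₃ hm₃ hm₁ h3 hm13.symm)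
        have k4 := hg.dimLE_insert_two k3 (v := m₂) (s := b₁) (t := b₃) (by simp) (by simp) hb13
          (hmiss hb₁ hm₁ hm₂ h1 hm12).symm (hmiss hb₃ hm₃ hm₂ h3 hm23.symm).symm
        refine hg.dimLE_univ k4 fun v => ?_
        by_cases hv : v ∈ A
        · rcases hAm v hv with rfl | rfl | rfl <;> simp
        · exact Or.inr (htwo hv hm₁ hm₂ hm₃ hm12 hm13 hm23 (by simp) (by simp) (by simp))
      by_cases hbb : Gᶜ.Adj b₁ b₂
      · exact key b₁ b₂ b₃ m₁ m₂ m₃ hb₁ hb₂ hb₃ hm₁ hm₂ hm₃ hbm₁ hbm₂ hbm₃ h31.symm h32.symm hm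
          hm13 hm23 hAm hbb
      obtain ⟨e, he⟩ := hf.adj (adj_of_not_compl_adj hb hbb)
      obtain ⟨k, hk⟩ : ∃ k, k ∉ ({i, e} : Finset ι) := by
        by_contra! h
        have h1 := Finset.card_le_card (fun k _ => h k : Finset.univ ⊆ ({i, e} : Finset ι))
        have h2 := Finset.card_le_two (a := i) (b := e)
        rw [Finset.card_univ] at h1
        omega
      rw [Finset.mem_insert, Finset.mem_singleton, not_or] at hk
      have hbk : f b₃ k ≠ f b₁ k := by
        intro h
        obtain ⟨u, v, huv⟩ := hf.nonconst k
        have hall : ∀ w, f w k = f b₁ k := by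
          intro w
          by_cases hw : w ∈ A
          · rcases hAm w hw with rfl | rfl | rfl
            · exact (hf.eq_off hbm₁ (hi hw hb₁) k hk.1).symm
            · exact (hf.eq_off hbm₂ (hi hw hb₂) k hk.1).symm.trans (he k hk.2).symm
            · exact (hf.eq_off hbm₃ (hi hw hb₃) k hk.1).symm.trans h
          · rcases hBm w hw with rfl | rfl | rfl
            exacts [rfl, (he k hk.2).symm, h]
        exact huv ((hall u).trans (hall v).symm)
      rcases hf.compl_adj_or hb he hk.2 hbk with h | h
      · exact key b₁ b₃ b₂ m₁ m₃ m₂ hb₁ hb₃ hb₂ hm₁ hm₃ hm₂ hbm₁ hbm₃ hbm₂ hb h32 hm13 hm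
          hm23.symm (fun a ha => by have := hAm a ha; tauto) h.symm
      · exact key b₂ b₃ b₁ m₂ m₃ m₁ hb₂ hb₃ hb₁ hm₂ hm₃ hm₁ hbm₂ hbm₃ hbm₁ hb.symm h31 hm23
          hm.symm hm13.symm (fun a ha => by have := hAm a ha; tauto) h.symm
  · push Not at hb₃
    have hcov : ∀ v, v ∈ A' ∨ v = b₁ ∨ v = b₂ ∨ v = m₁ ∨ v = m₂ := by
      intro v
      by_cases hv : v ∈ A
      · by_cases h : v ∈ A'
        · exact Or.inl h
        · rw [hA'mem] at h
          tauto
      · have := hb₃ v hv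
        tauto
    by_cases hbb : Gᶜ.Adj b₁ b₂
    · have h1 := hunion (hg.dimLE_triangle hbb (hA'1 hx) (hA'2 hx)) (by simp) (by simp)
      refine hg.dimLE_univ_of_subset hG (T := {m₁, m₂}) h1 ⟨b₁, by simp⟩ (fun v hv => ?_) hpair
        le_rfl
      rcases hcov v with h | rfl | rfl | rfl | rfl
      · exact (hv (by simp [h])).elim
      · exact (hv (by simp)).elim
      · exact (hv (by simp)).elim
      · simp
      · simp
    · obtain ⟨e, he⟩ := hf.adj (adj_of_not_compl_adj hb hbb)
      have hme : ∀ j, j ≠ e → f m₁ j = f m₂ j := by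
        intro j hj
        by_cases hji : j = i
        · exact hji ▸ hAi hm₁ hm₂
        · rw [← hf.eq_off hbm₁ (hi hm₁ hb₁) j hji, ← hf.eq_off hbm₂ (hi hm₂ hb₂) j hji, he j hj]
      obtain ⟨k, hk⟩ : ∃ k, k ∉ ({i, e} : Finset ι) := by
        by_contra! h
        have h1 := Finset.card_le_card (fun k _ => h k : Finset.univ ⊆ ({i, e} : Finset ι))
        have h2 := Finset.card_le_two (a := i) (b := e)
        rw [Finset.card_univ] at h1
        omega
      rw [Finset.mem_insert, Finset.mem_singleton, not_or] at hk
      obtain ⟨w, hw⟩ : ∃ w, f w k ≠ f m₁ k := by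
        by_contra! h
        obtain ⟨u, v, huv⟩ := hf.nonconst k
        exact huv ((h u).trans (h v).symm)
      have hwA : w ∈ A' := by
        have hbk := hf.eq_off hbm₁ (hi hm₁ hb₁) k hk.1
        rcases hcov w with h | rfl | rfl | rfl | rfl
        · exact h
        · exact (hw hbk).elim
        · exact (hw ((he k hk.2).symm.trans hbk)).elim
        · exact (hw rfl).elim
        · exact (hw (hme k hk.2).symm).elim
      have h1 : DimLE g {b₂, b₁, w} 2 :=
        hg.dimLE_insert (hg.dimLE_pair (hA'1 hwA)) (s := w) (by simp) (hA'2 hwA)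
      have h2 := hunion h1 (by simp) (by simp)
      rcases hf.compl_adj_or hm hme hk.2 hw with h | h
      · have h3 := hg.dimLE_insert_two h2 (v := m₁) (s := b₂) (t := w) (by simp) (by simp)
          (hA'2 hwA).ne h21.symm h.symm
        refine hg.dimLE_univ_of_subset hG (T := {m₂}) h3 ⟨m₁, by simp⟩ (fun v hv => ?_)
          (Set.ncard_singleton _).le le_rfl
        rcases hcov v with h | rfl | rfl | rfl | rfl
        · exact (hv (by simp [h])).elim
        · exact (hv (by simp)).elim
        · exact (hv (by simp)).elim
        · exact (hv (by simp)).elim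
        · simp
      · have h3 := hg.dimLE_insert_two h2 (v := m₂) (s := b₁) (t := w) (by simp) (by simp)
          (hA'1 hwA).ne h12.symm h.symm
        refine hg.dimLE_univ_of_subset hG (T := {m₁}) h3 ⟨m₂, by simp⟩ (fun v hv => ?_)
          (Set.ncard_singleton _).le le_rfl
        rcases hcov v with h | rfl | rfl | rfl | rfl
        · exact (hv (by simp [h])).elim
        · exact (hv (by simp)).elim
        · exact (hv (by simp)).elim
        · simp
        · exact (hv (by simp)).elim

/-- If all classes of two coordinates have at most two vertices, then all degrees of `G` are at
most two, so that in the complement each vertex has a neighbor in any set of three others. -/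
theorem IsHammingEmbedding.dimLE_compl_of_small_classes (hf : G.IsHammingEmbedding f)
    (hg : Gᶜ.IsHammingEmbedding g) (hV : 5 ≤ Fintype.card V) {i j : ι} (hij : i ≠ j)
    (hi : ∀ u v w, u ≠ v → u ≠ w → v ≠ w → f u i = f v i → f u i = f w i → False)
    (hj : ∀ u v w, u ≠ v → u ≠ w → v ≠ w → f u j = f v j → f u j = f w j → False) :
    DimLE g Set.univ 3 := by
  classical
  have hdeg : ∀ p x y z, G.Adj p x → G.Adj p y → G.Adj p z → x ≠ y → x ≠ z → y ≠ z → False := by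
    intro p x y z hx hy hz hxy hxz hyz
    have key : ∀ q, G.Adj p q → f p i = f q i ∨ f p j = f q j := by
      intro q hq
      by_contra! h
      exact ((compl_adj G p q).1 (hf.compl_adj_of_ne_of_ne hij h.1 h.2)).2 hq
    rcases key x hx with h1 | h1 <;> rcases key y hy with h2 | h2 <;>
      rcases key z hz with h3 | h3
    · exact hi p x y hx.ne hy.ne hxy h1 h2
    · exact hi p x y hx.ne hy.ne hxy h1 h2
    · exact hi p x z hx.ne hz.ne hxz h1 h3
    · exact hj p y z hy.ne hz.ne hyz h2 h3
    · exact hi p y z hy.ne hz.ne hyz h2 h3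
    · exact hj p x z hx.ne hz.ne hxz h1 h3
    · exact hj p x y hx.ne hy.ne hxy h1 h2
    · exact hj p x y hx.ne hy.ne hxy h1 h2
  obtain ⟨p⟩ : Nonempty V := Fintype.card_pos_iff.1 (by omega)
  have h2 : G.degree p ≤ 2 := by
    by_contra! h
    rw [← card_neighborFinset_eq_degree, Finset.two_lt_card_iff] at h
    obtain ⟨x, y, z, hx, hy, hz, hxy, hxz, hyz⟩ := h
    rw [mem_neighborFinset] at hx hy hz
    exact hdeg p x y z hx hy hz hxy hxz hyz
  have h3 : 1 < (Gᶜ.neighborFinset p).card := by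
    rw [card_neighborFinset_eq_degree, degree_compl]
    omega
  obtain ⟨x, hx, y, hy, hxy⟩ := Finset.one_lt_card.1 h3
  rw [mem_neighborFinset] at hx hy
  obtain ⟨u, hu⟩ : ∃ u, u ∉ ({p, x, y} : Finset V) := by
    by_contra! h
    have h1 := Finset.card_le_card (fun k _ => h k : Finset.univ ⊆ ({p, x, y} : Finset V))
    have h2 := Finset.card_le_three (a := p) (b := x) (c := y)
    rw [Finset.card_univ] at h1
    omega
  simp only [Finset.mem_insert, Finset.mem_singleton, not_or] at hu
  have hS : DimLE g {y, x, p} 2 :=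
    hg.dimLE_insert (hg.dimLE_pair hx.symm) (s := p) (by simp) hy.symm
  have hthree : ∀ v a b c, v ≠ a → v ≠ b → v ≠ c → a ≠ b → a ≠ c → b ≠ c →
      ¬ Gᶜ.Adj v a → ¬ Gᶜ.Adj v b → ¬ Gᶜ.Adj v c → False :=
    fun v a b c ha hb hc hab hac hbc h1 h2 h3 => hdeg v a b c (adj_of_not_compl_adj ha h1)
      (adj_of_not_compl_adj hb h2) (adj_of_not_compl_adj hc h3) hab hac hbc
  obtain ⟨s, hs, hus⟩ : ∃ s ∈ ({y, x, p} : Set V), Gᶜ.Adj u s := by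
    by_contra! h
    exact hthree u p x y hu.1 hu.2.1 hu.2.2 hx.ne hy.ne hxy (h p (by simp)) (h x (by simp))
      (h y (by simp))
  refine hg.dimLE_univ (hg.dimLE_insert hS hs hus) fun v => ?_
  by_cases hv : v ∈ (insert u {y, x, p} : Set V)
  · exact Or.inl hv
  simp only [Set.mem_insert_iff, Set.mem_singleton_iff, not_or] at hv
  obtain ⟨hvu, hvy, hvx, hvp⟩ := hv
  right
  by_cases h : Gᶜ.Adj v u
  · obtain ⟨t, ht, hvt⟩ : ∃ t ∈ ({y, x, p} : Set V), Gᶜ.Adj v t := by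
      by_contra! h
      exact hthree v p x y hvp hvx hvy hx.ne hy.ne hxy (h p (by simp)) (h x (by simp))
        (h y (by simp))
    refine ⟨u, by simp, t, by simp [ht], ?_, h, hvt⟩
    rintro rfl
    simp only [Set.mem_insert_iff, Set.mem_singleton_iff] at ht
    tauto
  · refine exists_two_of_three (x := p) (y := x) (z := y) (by simp) (by simp) (by simp) hx.ne hy.ne
      hxy ?_ ?_ ?_
    · exact hthree v u p x hvu hvp hvx hu.1 hu.2.1 hx.ne h
    · exact hthree v u p y hvu hvp hvy hu.1 hu.2.2 hy.ne h
    · exact hthree v u x y hvu hvx hvy hu.2.1 hu.2.2 hxy h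

/-- If each of two coordinates is constant up to one vertex, then these two vertices are distinct
leaves of `G`. In the complement they are adjacent, and at most two of the other vertices are not
joined to both of them. -/
theorem IsHammingEmbedding.dimLE_compl_of_leaves (hf : G.IsHammingEmbedding f)
    (hg : Gᶜ.IsHammingEmbedding g) (hG : G.Connected) (hG' : Gᶜ.Connected)
    (hV : 5 ≤ Fintype.card V) {i j : ι} (hij : i ≠ j) {b b' : V}
    (hi : ∀ u v, u ≠ b → v ≠ b → f u i = f v i)
    (hj : ∀ u v, u ≠ b' → v ≠ b' → f u j = f v j) : DimLE g Set.univ 3 := by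
  classical
  have hne : ∀ k c, (∀ u v, u ≠ c → v ≠ c → f u k = f v k) → ∀ u, u ≠ c → f c k ≠ f u k := by
    intro k c hk u hu h
    obtain ⟨x, y, hxy⟩ := hf.nonconst k
    have : ∀ z, f z k = f u k := by
      intro z
      by_cases hz : z = c
      · exact hz ▸ h
      · exact hk z u hz hu
    exact hxy ((this x).trans (this y).symm)
  have hone : ∀ k c, (∀ u v, u ≠ c → v ≠ c → f u k = f v k) → ∀ u v, u ≠ v → u ≠ c → v ≠ c →
      ¬ Gᶜ.Adj c u → Gᶜ.Adj c v := by
    intro k c hk u v huv hu hv h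
    refine compl_adj_of_not_adj hv.symm fun h' => huv ?_
    exact hf.eq_of_adj_of_adj (hk u v hu hv) (hne k c hk u hu) (adj_of_not_compl_adj hu.symm h) h'
  have hbb : b ≠ b' := by
    rintro rfl
    have : Nontrivial V := Fintype.one_lt_card_iff_nontrivial.1 (by omega)
    obtain ⟨c, hc⟩ := hG.preconnected.exists_adj_of_nontrivial b
    exact ((compl_adj G b c).1 (hf.compl_adj_of_ne_of_ne hij (hne i b hi c hc.ne')
      (hne j b hj c hc.ne'))).2 hc
  have hadj : Gᶜ.Adj b b' :=
    hf.compl_adj_of_ne_of_ne hij (hne i b hi b' hbb.symm) (hne j b' hj b hbb).symm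
  -- At most two of the remaining vertices, of which there are at least three, miss `b` or `b'`
  -- in the complement.
  have hrest : 2 < (Finset.univ.erase b |>.erase b').card := by
    rw [Finset.card_erase_of_mem (by simp [hbb.symm]), Finset.card_erase_of_mem (by simp),
      Finset.card_univ]
    omega
  set N : Set V := {v | v ≠ b ∧ v ≠ b' ∧ Gᶜ.Adj b v ∧ Gᶜ.Adj b' v} with hN
  have hmiss : {v | v ≠ b ∧ v ≠ b' ∧ v ∉ N}.ncard ≤ 2 := by
    by_contra! h
    rw [Set.two_lt_ncard_iff] at h
    obtain ⟨x, y, z, hx, hy, hz, hxy, hxz, hyz⟩ := h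
    have key : ∀ x, x ∈ {v | v ≠ b ∧ v ≠ b' ∧ v ∉ N} → x ≠ b ∧ x ≠ b' ∧
        (¬ Gᶜ.Adj b x ∨ ¬ Gᶜ.Adj b' x) := by
      rintro x ⟨h1, h2, h3⟩
      refine ⟨h1, h2, ?_⟩
      by_contra! h
      exact h3 ⟨h1, h2, h.1, h.2⟩
    obtain ⟨hxb, hxb', hx⟩ := key x hx
    obtain ⟨hyb, hyb', hy⟩ := key y hy
    obtain ⟨hzb, hzb', hz⟩ := key z hz
    have k1 := hone i b hi x y hxy hxb hyb
    have k2 := hone i b hi x z hxz hxb hzb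
    have k3 := hone i b hi y z hyz hyb hzb
    have k4 := hone j b' hj x y hxy hxb' hyb'
    have k5 := hone j b' hj x z hxz hxb' hzb'
    have k6 := hone j b' hj y z hyz hyb' hzb'
    rcases hx with hx | hx <;> rcases hy with hy | hy <;> rcases hz with hz | hz <;>
      first
        | exact hy (k1 hx) | exact hz (k2 hx) | exact hz (k3 hy)
        | exact hy (k4 hx) | exact hz (k5 hx) | exact hz (k6 hy)
  obtain ⟨c, hc⟩ : N.Nonempty := by
    by_contra! h
    rw [h] at hmiss
    have : {v | v ≠ b ∧ v ≠ b' ∧ v ∉ (∅ : Set V)} =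
        ((Finset.univ.erase b |>.erase b' : Finset V) : Set V) := by
      ext v
      simp
    rw [this, Set.ncard_coe_finset] at hmiss
    omega
  have h1 := hg.dimLE_union (T := N) (hg.dimLE_triangle hadj hc.2.2.1 hc.2.2.2) fun v hv =>
    Or.inr ⟨b, by simp, b', by simp, hbb, hv.2.2.1.symm, hv.2.2.2.symm⟩
  refine hg.dimLE_univ_of_subset hG' (T := {v | v ≠ b ∧ v ≠ b' ∧ v ∉ N}) h1 ⟨b, by simp⟩
    (fun v hv => ?_) hmiss le_rfl
  refine ⟨?_, ?_, fun h => hv (Or.inr h)⟩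
  · rintro rfl; simp at hv
  · rintro rfl; simp at hv

/-- If `G` has at least three directions, then its complement has at most three. -/
theorem md_compl_le_three (hG : G.Connected) (hG' : Gᶜ.Connected) (hV : 5 ≤ Fintype.card V)
    (hmd : 3 ≤ G.md) : Gᶜ.md ≤ 3 := by
  classical
  obtain ⟨ι, _, f, hf, hι⟩ := exists_isHammingEmbedding hG
  obtain ⟨κ, _, g, hg, hκ⟩ := exists_isHammingEmbedding hG'
  rw [← hκ]
  refine hg.card_le_of_dimLE ?_
  by_contra hD
  rw [← hι] at hmd
  have htype : ∀ i, (∃ b, ∀ u v, u ≠ b → v ≠ b → f u i = f v i) ∨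
      ∀ u v w, u ≠ v → u ≠ w → v ≠ w → f u i = f v i → f u i = f w i → False := by
    intro i
    by_contra! h
    obtain ⟨h1, u, v, w, huv, huw, hvw, hfv, hfw, -⟩ := h
    set A : Finset V := Finset.univ.filter fun x => f x i = f u i with hA
    have hAm : ∀ x, x ∈ A ↔ f x i = f u i := by simp [A]
    have hcard : 3 ≤ A.card := Finset.two_lt_card_iff.2
      ⟨u, v, w, (hAm u).2 rfl, (hAm v).2 hfv.symm, (hAm w).2 hfw.symm, huv, huw, hvw⟩
    obtain ⟨b, hb⟩ : ∃ b, b ∉ A := by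
      by_contra! h
      obtain ⟨x, y, hxy⟩ := hf.nonconst i
      exact hxy (((hAm x).1 (h x)).trans ((hAm y).1 (h y)).symm)
    refine hD ?_
    obtain ⟨b', hb', hbb⟩ : ∃ b', b' ∉ A ∧ b' ≠ b := by
      by_contra! h
      obtain ⟨x, y, hx, hy, hxy⟩ := h1 b
      have key : ∀ z, z ≠ b → f z i = f u i := fun z hz =>
        (hAm z).1 (by_contra fun h' => hz (h z h'))
      exact hxy ((key x hx).trans (key y hy).symm)
    exact hf.dimLE_compl_of_class hg hG' hmd hAm hcard hbb hb' hb
  rw [← Finset.card_univ] at hmd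
  obtain ⟨i, j, k, -, -, -, hij, hik, hjk⟩ := Finset.two_lt_card_iff.1 hmd
  rcases htype i with ⟨b, hi⟩ | hi <;> rcases htype j with ⟨b', hj⟩ | hj
  · exact hD (hf.dimLE_compl_of_leaves hg hG hG' hV hij hi hj)
  · rcases htype k with ⟨b', hk⟩ | hk
    · exact hD (hf.dimLE_compl_of_leaves hg hG hG' hV hik hi hk)
    · exact hD (hf.dimLE_compl_of_small_classes hg hV hjk hj hk)
  · rcases htype k with ⟨b, hk⟩ | hk
    · exact hD (hf.dimLE_compl_of_leaves hg hG hG' hV hjk hj hk)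
    · exact hD (hf.dimLE_compl_of_small_classes hg hV hik hi hk)
  · exact hD (hf.dimLE_compl_of_small_classes hg hV hij hi hj)

theorem md_mul_md_compl_le (hG : G.Connected) (hG' : Gᶜ.Connected) (hV : 5 ≤ Fintype.card V) :
    G.md * Gᶜ.md ≤ max 9 (2 * (Fintype.card V - 1)) := by
  have h1 := md_le_card_sub_one hG
  have h2 := md_le_card_sub_one hG'
  rcases le_or_gt 3 G.md with h3 | h3
  · have h4 := md_compl_le_three hG hG' hV h3
    rcases h4.lt_or_eq with h5 | h5
    · exact le_max_of_le_right (by nlinarith)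
    · have h6 := md_compl_le_three (G := Gᶜ) hG' (by rwa [compl_compl]) hV h5.ge
      rw [compl_compl] at h6
      exact le_max_of_le_left (by nlinarith)
  · exact le_max_of_le_right (by nlinarith)

end Complement

/-! ### Graphs with five or six vertices -/

section Small

variable {G : SimpleGraph V}

theorem exists_of_not_isMatchingCut {A : Set V} (h : ¬ G.IsMatchingCut A) (hA : A.Nonempty)
    (hA' : Aᶜ.Nonempty) :
    (∃ a ∈ A, ∃ u ∉ A, ∃ v ∉ A, u ≠ v ∧ G.Adj a u ∧ G.Adj a v) ∨
      ∃ b ∉ A, ∃ u ∈ A, ∃ v ∈ A, u ≠ v ∧ G.Adj b u ∧ G.Adj b v := by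
  by_contra! h'
  refine h ⟨hA, hA', fun a ha u hu v hv h1 h2 => ?_, fun b hb u hu v hv h1 h2 => ?_⟩
  · by_contra hne
    exact h'.1 a ha u hu v hv hne h1 h2
  · by_contra hne
    exact h'.2 b hb u hu v hv hne h1 h2

theorem exists_two_adj_of_not_isMatchingCut [Nontrivial V]
    (h : ∀ A : Set V, ¬ G.IsMatchingCut A) (v : V) : ∃ u w, u ≠ w ∧ G.Adj v u ∧ G.Adj v w := by
  obtain ⟨w, hw⟩ := exists_ne v
  rcases exists_of_not_isMatchingCut (h {v}) ⟨v, rfl⟩ ⟨w, hw⟩ with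
    ⟨_, rfl, u, -, w, -, h⟩ | ⟨b, -, _, rfl, _, rfl, h, -⟩
  · exact ⟨u, w, h⟩
  · exact (h rfl).elim

/-- Every vertex has at most three neighbors. -/
def MaxDegreeLEThree (G : SimpleGraph V) : Prop :=
  ∀ v a b c d : V, [a, b, c, d].Nodup → G.Adj v a → G.Adj v b → G.Adj v c → G.Adj v d → False

/-- If the three vertices of a triangle do not form one side of a matching cut, then two triangles
share an edge. -/
theorem exists_diamond_of_triangle [Fintype V] (hV : 4 ≤ Fintype.card V)
    (hM : ∀ A : Set V, ¬ G.IsMatchingCut A) (hD : G.MaxDegreeLEThree) {a b c : V}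
    (hab : G.Adj a b) (hac : G.Adj a c) (hbc : G.Adj b c) :
    ∃ a b c x, G.Adj a b ∧ G.Adj a c ∧ G.Adj b c ∧ G.Adj x a ∧ G.Adj x b ∧ x ≠ c := by
  classical
  obtain ⟨y, hy⟩ : ∃ u, u ∉ ({a, b, c} : Finset V) := by
    by_contra! h
    have h1 := Finset.card_le_card (fun k _ => h k : Finset.univ ⊆ ({a, b, c} : Finset V))
    have h2 := Finset.card_le_three (a := a) (b := b) (c := c)
    rw [Finset.card_univ] at h1
    omega
  rcases exists_of_not_isMatchingCut (hM {a, b, c}) ⟨a, by simp⟩ ⟨y, by simpa using hy⟩ with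
    ⟨s, hs, u, hu, v, hv, huv, h1, h2⟩ | ⟨x, hx, u, hu, v, hv, huv, h1, h2⟩
  · simp only [Set.mem_insert_iff, Set.mem_singleton_iff, not_or] at hs hu hv
    rcases hs with rfl | rfl | rfl
    · exact (hD s b c u v (by grind [Adj.ne]) hab hac h1 h2).elim
    · exact (hD s a c u v (by grind [Adj.ne]) hab.symm hbc h1 h2).elim
    · exact (hD s a b u v (by grind [Adj.ne]) hac.symm hbc.symm h1 h2).elim
  · simp only [Set.mem_insert_iff, Set.mem_singleton_iff, not_or] at hx hu hv
    have hba := hab.symm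
    have hca := hac.symm
    have hcb := hbc.symm
    rcases hu with rfl | rfl | rfl <;> rcases hv with rfl | rfl | rfl
    · exact (huv rfl).elim
    · exact ⟨u, v, c, x, hab, hac, hbc, h1, h2, hx.2.2⟩
    · exact ⟨u, v, b, x, hac, hab, hcb, h1, h2, hx.2.1⟩
    · exact ⟨u, v, c, x, hba, hbc, hac, h1, h2, hx.2.2⟩
    · exact (huv rfl).elim
    · exact ⟨u, v, a, x, hbc, hba, hca, h1, h2, hx.1⟩
    · exact ⟨u, v, b, x, hca, hcb, hab, h1, h2, hx.2.1⟩
    · exact ⟨u, v, a, x, hcb, hca, hba, h1, h2, hx.1⟩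
    · exact (huv rfl).elim

/-- In a triangle-free graph without matching cuts, the ends of an edge do not form one side of a
matching cut, so there is a vertex with three neighbors. -/
theorem exists_three_adj_of_triangleFree [Fintype V] (hV : 3 ≤ Fintype.card V)
    (hM : ∀ A : Set V, ¬ G.IsMatchingCut A)
    (hT : ∀ a b c, G.Adj a b → G.Adj a c → G.Adj b c → False) :
    ∃ v x y z, x ≠ y ∧ x ≠ z ∧ y ≠ z ∧ G.Adj v x ∧ G.Adj v y ∧ G.Adj v z := by
  classical
  have : Nontrivial V := Fintype.one_lt_card_iff_nontrivial.1 (by omega)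
  obtain ⟨a⟩ : Nonempty V := inferInstance
  obtain ⟨b, -, -, hab, -⟩ := exists_two_adj_of_not_isMatchingCut hM a
  obtain ⟨y, hy⟩ : ∃ u, u ∉ ({a, b} : Finset V) := by
    by_contra! h
    have h1 := Finset.card_le_card (fun k _ => h k : Finset.univ ⊆ ({a, b} : Finset V))
    have h2 := Finset.card_le_two (a := a) (b := b)
    rw [Finset.card_univ] at h1
    omega
  rcases exists_of_not_isMatchingCut (hM {a, b}) ⟨a, by simp⟩ ⟨y, by simpa using hy⟩ with
    ⟨s, hs, u, hu, v, hv, huv, h1, h2⟩ | ⟨x, hx, u, hu, v, hv, huv, h1, h2⟩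
  · simp only [Set.mem_insert_iff, Set.mem_singleton_iff, not_or] at hs hu hv
    rcases hs with rfl | rfl
    · exact ⟨s, b, u, v, Ne.symm hu.2, Ne.symm hv.2, huv, hab, h1, h2⟩
    · exact ⟨s, a, u, v, Ne.symm hu.1, Ne.symm hv.1, huv, hab.symm, h1, h2⟩
  · simp only [Set.mem_insert_iff, Set.mem_singleton_iff] at hu hv
    rcases hu with rfl | rfl <;> rcases hv with rfl | rfl
    · exact (huv rfl).elim
    · exact (hT _ _ _ h1 h2 hab).elim
    · exact (hT _ _ _ h2 h1 hab).elim
    · exact (huv rfl).elim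

/-- A list of distinct vertices that is as long as possible contains all vertices. -/
theorem mem_of_nodup_of_length [Fintype V] {l : List V} (hl : l.Nodup)
    (hlen : Fintype.card V ≤ l.length) (v : V) : v ∈ l := by
  classical
  have := Finset.eq_univ_of_card l.toFinset
    (le_antisymm (Finset.card_le_univ _) (by rwa [List.toFinset_card_of_nodup hl]))
  exact List.mem_toFinset.1 (this ▸ Finset.mem_univ v)

theorem exists_notMem_of_length [Fintype V] {l : List V} (hlen : l.length < Fintype.card V) :
    ∃ v, v ∉ l := by
  classical
  by_contra! h
  have h1 := Finset.card_le_card (fun k _ => List.mem_toFinset.2 (h k) : Finset.univ ⊆ l.toFinset)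
  have h2 := List.toFinset_card_le l
  rw [Finset.card_univ] at h1
  omega

theorem exists_isMatchingCut_of_card_eq_five [Fintype V] (hV : Fintype.card V = 5)
    (hG' : Gᶜ.Connected) : ∃ A : Set V, G.IsMatchingCut A := by
  classical
  by_contra! hM
  have : Nontrivial V := Fintype.one_lt_card_iff_nontrivial.1 (by omega)
  have h2 := exists_two_adj_of_not_isMatchingCut hM
  have hD : G.MaxDegreeLEThree := by
    intro v a b c d hl ha hb hc hd
    have hall := mem_of_nodup_of_length (l := [v, a, b, c, d]) (by grind [Adj.ne]) (by simp [hV])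
    obtain ⟨w, hw⟩ := hG'.preconnected.exists_adj_of_nontrivial v
    have := hall w
    rw [compl_adj] at hw
    grind
  have hT : ∀ a b c, G.Adj a b → G.Adj a c → G.Adj b c → False := by
    intro a b c hab hac hbc
    obtain ⟨a, b, c, x, hab, hac, hbc, hxa, hxb, hxc⟩ :=
      exists_diamond_of_triangle (by omega) hM hD hab hac hbc
    have h4 : [a, b, c, x].Nodup := by grind [Adj.ne]
    obtain ⟨z, hz⟩ := exists_notMem_of_length (l := [a, b, c, x]) (by simp [hV])
    have hall := mem_of_nodup_of_length (l := [z, a, b, c, x]) (by grind [Adj.ne]) (by simp [hV])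
    have hza : ¬ G.Adj z a := fun h => hD a b c x z (by grind [Adj.ne]) hab hac hxa.symm h.symm
    have hzb : ¬ G.Adj z b := fun h => hD b a c x z (by grind [Adj.ne]) hab.symm hbc hxb.symm h.symm
    obtain ⟨u, w, huw, hu, hw⟩ := h2 z
    have hz' : G.Adj z c ∧ G.Adj z x := by
      have := hall u
      have := hall w
      have := hu.ne
      have := hw.ne
      grind
    obtain ⟨p, hp, q, hq, hpq⟩ := hG'.exists_adj_of_mem_of_notMem (A := {c, x}) (u := c) (v := a)
      (by simp) (by grind [Adj.ne])
    have := hall q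
    rw [compl_adj] at hpq
    grind [G.adj_comm]
  obtain ⟨v, x, y, z, hxy, hxz, hyz, hx, hy, hz⟩ :=
    exists_three_adj_of_triangleFree (by omega) hM hT
  obtain ⟨w, hw⟩ := exists_notMem_of_length (l := [v, x, y, z]) (by simp [hV])
  have hall := mem_of_nodup_of_length (l := [v, x, y, z, w]) (by grind [Adj.ne]) (by simp [hV])
  have hxy' := hT v x y hx hy
  have hxz' := hT v x z hx hz
  have hyz' := hT v y z hy hz
  have key : ∀ x y z, (∀ u, u ∈ [v, x, y, z, w]) → ¬ G.Adj x y → ¬ G.Adj x z → G.Adj x w := by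
    intro x y z hall hxy hxz
    obtain ⟨u, t, hut, hu, ht⟩ := h2 x
    have := hall u
    have := hall t
    have := hu.ne
    have := ht.ne
    grind
  have kx := key x y z hall hxy' hxz'
  have ky := key y x z (fun u => by have := hall u; grind) (fun h => hxy' h.symm) hyz'
  have kz := key z x y (fun u => by have := hall u; grind) (fun h => hxz' h.symm)
    (fun h => hyz' h.symm)
  obtain ⟨p, hp, q, hq, hpq⟩ := hG'.exists_adj_of_mem_of_notMem (A := {v, w}) (u := v) (v := x)
    (by simp) (by grind [Adj.ne])
  have := hall q
  rw [compl_adj] at hpq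
  grind [G.adj_comm]

theorem two_le_md_of_card_eq_five [Fintype V] (hV : Fintype.card V = 5) (hG : G.Connected)
    (hG' : Gᶜ.Connected) : 2 ≤ G.md := by
  obtain ⟨A, hA⟩ := exists_isMatchingCut_of_card_eq_five hV hG'
  exact hA.two_le_md hG (by rw [Nat.card_eq_fintype_card]; omega)

theorem triangleFree_of_card_eq_six [Fintype V] (hV : Fintype.card V = 6)
    (hM : ∀ A : Set V, ¬ G.IsMatchingCut A) (hD : G.MaxDegreeLEThree) :
    ∀ a b c, G.Adj a b → G.Adj a c → G.Adj b c → False := by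
  classical
  have : Nontrivial V := Fintype.one_lt_card_iff_nontrivial.1 (by omega)
  have h2 := exists_two_adj_of_not_isMatchingCut hM
  intro a b c hab hac hbc
  obtain ⟨a, b, c, x, hab, hac, hbc, hxa, hxb, hxc⟩ :=
    exists_diamond_of_triangle (by omega) hM hD hab hac hbc
  have h4 : [a, b, c, x].Nodup := by grind [Adj.ne]
  have hfull : ∀ z, z ∉ [a, b, c, x] → ¬ G.Adj z a ∧ ¬ G.Adj z b := fun z hz =>
    ⟨fun h => hD a b c x z (by grind [Adj.ne]) hab hac hxa.symm h.symm,
      fun h => hD b a c x z (by grind [Adj.ne]) hab.symm hbc hxb.symm h.symm⟩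
  obtain ⟨y, hy⟩ := exists_notMem_of_length (l := [a, b, c, x]) (by simp [hV])
  rcases exists_of_not_isMatchingCut (hM {a, b, c, x}) ⟨a, by simp⟩ ⟨y, by simpa using hy⟩ with
    ⟨s, hs, u, hu, v, hv, huv, h1, h3⟩ | ⟨y, hy, u, hu, v, hv, huv, h1, h3⟩
  · simp only [Set.mem_insert_iff, Set.mem_singleton_iff, not_or] at hs hu hv
    rcases hs with rfl | rfl | rfl | rfl
    · exact hD s b c u v (by grind [Adj.ne]) hab hac h1 h3
    · exact hD s a c u v (by grind [Adj.ne]) hab.symm hbc h1 h3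
    · exact hD s a b u v (by grind [Adj.ne]) hac.symm hbc.symm h1 h3
    · exact hD s a b u v (by grind [Adj.ne]) hxa hxb h1 h3
  · have hy' : y ∉ [a, b, c, x] := by simpa using hy
    have hyab := hfull y hy'
    have hyc : G.Adj y c ∧ G.Adj y x := by
      simp only [Set.mem_insert_iff, Set.mem_singleton_iff] at hu hv
      grind
    obtain ⟨z, hz⟩ := exists_notMem_of_length (l := [a, b, c, x, y]) (by simp [hV])
    have hall := mem_of_nodup_of_length (l := [z, a, b, c, x, y]) (by grind [Adj.ne]) (by simp [hV])
    have hzab := hfull z (by grind [Adj.ne])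
    have hzc : ¬ G.Adj z c := fun h =>
      hD c a b y z (by grind [Adj.ne]) hac.symm hbc.symm hyc.1.symm h.symm
    have hzx : ¬ G.Adj z x := fun h => hD x a b y z (by grind [Adj.ne]) hxa hxb hyc.2.symm h.symm
    obtain ⟨u, t, hut, hu, ht⟩ := h2 z
    have key : ∀ w, G.Adj z w → w = y := by
      intro w hw
      have := hall w
      simp only [List.mem_cons, List.not_mem_nil, or_false] at this
      rcases this with rfl | rfl | rfl | rfl | rfl | rfl
      exacts [(hw.ne rfl).elim, (hzab.1 hw).elim, (hzab.2 hw).elim, (hzc hw).elim,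
        (hzx hw).elim, rfl]
    exact hut ((key u hu).trans (key t ht).symm)

/-- If three objects are split into two nonempty classes, then one object is alone in its class. -/
theorem exists_alone_of_split {P Q : V → Prop} {x y z : V}
    (hor : ∀ c ∈ ({x, y, z} : Set V), P c ∨ Q c) (hand : ∀ c, P c → Q c → False)
    (hP : P x ∨ P y ∨ P z) (hQ : Q x ∨ Q y ∨ Q z) :
    ∃ c ∈ ({x, y, z} : Set V), (P c ∧ ∀ w ∈ ({x, y, z} : Set V), P w → w = c) ∨
      (Q c ∧ ∀ w ∈ ({x, y, z} : Set V), Q w → w = c) := by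
  have hx : P x ∨ Q x := hor x (by simp)
  have hy : P y ∨ Q y := hor y (by simp)
  have hz : P z ∨ Q z := hor z (by simp)
  have ax := hand x
  have ay := hand y
  have az := hand z
  clear hor hand
  simp only [Set.mem_insert_iff, Set.mem_singleton_iff]
  by_cases hx' : P x <;> by_cases hy' : P y <;> by_cases hz' : P z
  · grind
  · exact ⟨z, by simp, Or.inr (by grind)⟩
  · exact ⟨y, by simp, Or.inr (by grind)⟩
  · exact ⟨x, by simp, Or.inl (by grind)⟩
  · exact ⟨x, by simp, Or.inr (by grind)⟩
  · exact ⟨y, by simp, Or.inl (by grind)⟩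
  · exact ⟨z, by simp, Or.inl (by grind)⟩
  · grind

/-- Two adjacent vertices `q`, `z` form one side of a matching cut if each has just one further
neighbor, and these are distinct. -/
theorem isMatchingCut_pair {q z p v : V} (hne : ∃ w, w ≠ q ∧ w ≠ z)
    (hq : ∀ w, G.Adj q w → w = z ∨ w = p) (hz : ∀ w, G.Adj z w → w = q ∨ w = v) (hpv : p ≠ v) :
    G.IsMatchingCut {q, z} := by
  refine ⟨⟨q, by simp⟩, ?_, ?_, ?_⟩
  · obtain ⟨w, hw⟩ := hne
    exact ⟨w, by simpa using hw⟩
  · intro a ha u hu w hw h1 h2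
    simp only [Set.mem_insert_iff, Set.mem_singleton_iff, not_or] at ha hu hw
    rcases ha with rfl | rfl
    · exact ((hq u h1).resolve_left hu.2).trans ((hq w h2).resolve_left hw.2).symm
    · exact ((hz u h1).resolve_left hu.1).trans ((hz w h2).resolve_left hw.1).symm
  · intro b hb u hu w hw h1 h2
    simp only [Set.mem_insert_iff, Set.mem_singleton_iff, not_or] at hb hu hw
    rcases hu with rfl | rfl <;> rcases hw with rfl | rfl
    · rfl
    · exact (hpv (((hq b h1.symm).resolve_left hb.2).symm.trans
        ((hz b h2.symm).resolve_left hb.1))).elim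
    · exact (hpv (((hq b h2.symm).resolve_left hb.2).symm.trans
        ((hz b h1.symm).resolve_left hb.1))).elim
    · rfl

/-- A graph on six vertices with maximum degree at most three and without matching cuts is
`K₃,₃` minus an edge, if its complement is connected. This complement consists of two triangles
and a bridge. -/
theorem three_le_md_compl_of_card_eq_six [Fintype V] (hV : Fintype.card V = 6)
    (hM : ∀ A : Set V, ¬ G.IsMatchingCut A) (hD : G.MaxDegreeLEThree)
    (hG' : Gᶜ.Connected) : 3 ≤ Gᶜ.md := by
  classical
  have : Nontrivial V := Fintype.one_lt_card_iff_nontrivial.1 (by omega)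
  have h2 := exists_two_adj_of_not_isMatchingCut hM
  have hT := triangleFree_of_card_eq_six hV hM hD
  obtain ⟨v, x, y, z, hxy, hxz, hyz, hx, hy, hz⟩ :=
    exists_three_adj_of_triangleFree (by omega) hM hT
  obtain ⟨p, hp⟩ := exists_notMem_of_length (l := [v, x, y, z]) (by simp [hV])
  obtain ⟨q, hq⟩ := exists_notMem_of_length (l := [v, x, y, z, p]) (by simp [hV])
  have hnd : [v, x, y, z, p, q].Nodup := by grind [Adj.ne]
  have hxy' := hT v x y hx hy
  have hxz' := hT v x z hx hz
  have hyz' := hT v y z hy hz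
  have hpv : ¬ G.Adj v p := fun h => hD v x y z p (by grind [Adj.ne]) hx hy hz h
  have hqv : ¬ G.Adj v q := fun h => hD v x y z q (by grind [Adj.ne]) hx hy hz h
  have hall := mem_of_nodup_of_length hnd (by simp [hV])
  simp only [List.mem_cons, List.not_mem_nil, or_false] at hall
  have hnbr : ∀ c, c = x ∨ c = y ∨ c = z → ∀ w, G.Adj c w → w = v ∨ w = p ∨ w = q := by
    intro c hc w hw
    rcases hc with rfl | rfl | rfl <;> rcases hall w with rfl | rfl | rfl | rfl | rfl | rfl <;>
      first
        | exact absurd hw G.irrefl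
        | exact absurd hw.symm ‹_›
        | exact absurd hw ‹_›
        | simp
  have hnbr' : ∀ r, r = p ∨ r = q → ∀ w, G.Adj r w → w = x ∨ w = y ∨ w = z ∨ w = p ∨ w = q := by
    intro r hr w hw
    rcases hr with rfl | rfl <;> rcases hall w with rfl | rfl | rfl | rfl | rfl | rfl <;>
      first
        | exact absurd hw G.irrefl
        | exact absurd hw.symm ‹_›
        | exact absurd hw ‹_›
        | simp
  have hcut : ∀ r r' c, r' ≠ v → (∀ w, G.Adj r w → w = c ∨ w = r') →
      (∀ w, G.Adj c w → w = r ∨ w = v) → False := by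
    intro r r' c hr h3 h4
    refine hM _ (isMatchingCut_pair ?_ h3 h4 hr)
    obtain ⟨w, hw⟩ := exists_notMem_of_length (l := [r, c]) (by simp [hV])
    exact ⟨w, by simpa using hw⟩
  have hvp : p ≠ v ∧ q ≠ v ∧ p ≠ q := by grind
  -- Each neighbor of `v` has a neighbor among `p` and `q`.
  have hor : ∀ c, c = x ∨ c = y ∨ c = z → G.Adj c p ∨ G.Adj c q := by
    intro c hc
    obtain ⟨u, w, huw, hu, hw⟩ := h2 c
    have h3 := hnbr c hc u hu
    have h4 := hnbr c hc w hw
    by_contra! h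
    have : ∀ u, G.Adj c u → u = v := by
      intro u hu
      rcases hnbr c hc u hu with rfl | rfl | rfl
      exacts [rfl, (h.1 hu).elim, (h.2 hu).elim]
    exact huw ((this u hu).trans (this w hw).symm)
  by_cases hpq : G.Adj p q
  · -- One of `p`, `q` has just one neighbor `c` among `x`, `y`, `z`.
    have hand : ∀ c, G.Adj c p → G.Adj c q → False := fun c h3 h4 => hT c p q h3 h4 hpq
    have hexp : G.Adj x p ∨ G.Adj y p ∨ G.Adj z p := by
      by_contra! h
      obtain ⟨u, w, huw, hu, hw⟩ := h2 p
      have : ∀ u, G.Adj p u → u = q := by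
        intro u hu
        rcases hnbr' p (Or.inl rfl) u hu with rfl | rfl | rfl | rfl | rfl
        exacts [(h.1 hu.symm).elim, (h.2.1 hu.symm).elim, (h.2.2 hu.symm).elim,
          (hu.ne rfl).elim, rfl]
      exact huw ((this u hu).trans (this w hw).symm)
    have hexq : G.Adj x q ∨ G.Adj y q ∨ G.Adj z q := by
      by_contra! h
      obtain ⟨u, w, huw, hu, hw⟩ := h2 q
      have : ∀ u, G.Adj q u → u = p := by
        intro u hu
        rcases hnbr' q (Or.inr rfl) u hu with rfl | rfl | rfl | rfl | rfl
        exacts [(h.1 hu.symm).elim, (h.2.1 hu.symm).elim, (h.2.2 hu.symm).elim, rfl,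
          (hu.ne rfl).elim]
      exact huw ((this u hu).trans (this w hw).symm)
    obtain ⟨c, hc, h⟩ : ∃ c, (c = x ∨ c = y ∨ c = z) ∧
        ((G.Adj c p ∧ ∀ w, w = x ∨ w = y ∨ w = z → G.Adj w p → w = c) ∨
          (G.Adj c q ∧ ∀ w, w = x ∨ w = y ∨ w = z → G.Adj w q → w = c)) := by
      have h3 : ∀ c, c ∈ ({x, y, z} : Set V) ↔ c = x ∨ c = y ∨ c = z := by simp
      simp only [← h3] at hor ⊢
      exact exists_alone_of_split hor hand hexp hexq
    rcases h with ⟨h3, h4⟩ | ⟨h3, h4⟩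
    · refine (hcut p q c hvp.2.1 (fun w hw => ?_) fun w hw => ?_).elim
      · rcases hnbr' p (Or.inl rfl) w hw with h | h | h | h | h
        · exact Or.inl (h4 w (Or.inl h) hw.symm)
        · exact Or.inl (h4 w (Or.inr (Or.inl h)) hw.symm)
        · exact Or.inl (h4 w (Or.inr (Or.inr h)) hw.symm)
        · exact (hw.ne h.symm).elim
        · exact Or.inr h
      · rcases hnbr c hc w hw with h | h | h
        · exact Or.inr h
        · exact Or.inl h
        · exact (hand c h3 (h ▸ hw)).elim
    · refine (hcut q p c hvp.1 (fun w hw => ?_) fun w hw => ?_).elim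
      · rcases hnbr' q (Or.inr rfl) w hw with h | h | h | h | h
        · exact Or.inl (h4 w (Or.inl h) hw.symm)
        · exact Or.inl (h4 w (Or.inr (Or.inl h)) hw.symm)
        · exact Or.inl (h4 w (Or.inr (Or.inr h)) hw.symm)
        · exact Or.inr h
        · exact (hw.ne h.symm).elim
      · rcases hnbr c hc w hw with h | h | h
        · exact Or.inr h
        · exact (hand c (h ▸ hw) h3).elim
        · exact Or.inl h
  · -- Now `G` is bipartite with parts `{v, p, q}` and `{x, y, z}`, and it misses exactly one of
    -- the edges between them.
    have hqp : ¬ G.Adj q p := fun h => hpq h.symm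
    have hnbr'' : ∀ r, r = p ∨ r = q → ∀ w, G.Adj r w → w = x ∨ w = y ∨ w = z := by
      intro r hr w hw
      rcases hnbr' r hr w hw with h | h | h | rfl | rfl
      · exact Or.inl h
      · exact Or.inr (Or.inl h)
      · exact Or.inr (Or.inr h)
      · rcases hr with rfl | rfl
        exacts [(hw.ne rfl).elim, (hqp hw).elim]
      · rcases hr with rfl | rfl
        exacts [(hpq hw).elim, (hw.ne rfl).elim]
    have hP : ∀ r, r = p ∨ r = q → ∀ b c, (b = x ∨ b = y ∨ b = z) → (c = x ∨ c = y ∨ c = z) →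
        b ≠ c → ¬ G.Adj r b → ¬ G.Adj r c → False := by
      intro r hr b c hb hc hbc h3 h4
      obtain ⟨u, w, huw, hu, hw⟩ := h2 r
      have h5 := hnbr'' r hr u hu
      have h6 := hnbr'' r hr w hw
      have h7 : u ≠ b := by rintro rfl; exact h3 hu
      have h8 : u ≠ c := by rintro rfl; exact h4 hu
      have h9 : w ≠ b := by rintro rfl; exact h3 hw
      have h10 : w ≠ c := by rintro rfl; exact h4 hw
      clear hor hnbr hnbr' hnbr'' hcut hall hM hT hD h2 hG' hp hq
      grind
    have hR : ∀ r r' b c, (r = p ∧ r' = q ∨ r = q ∧ r' = p) → (b = x ∨ b = y ∨ b = z) →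
        (c = x ∨ c = y ∨ c = z) → b ≠ c → ¬ G.Adj r b → ¬ G.Adj r' c → False := by
      intro r r' b c hr hb hc hbc h3 h4
      obtain ⟨d, hdv, hd⟩ : ∃ d, d ≠ v ∧ ∀ w, w = x ∨ w = y ∨ w = z → w = b ∨ w = c ∨ w = d := by
        rcases hb with rfl | rfl | rfl <;> rcases hc with rfl | rfl | rfl
        · exact (hbc rfl).elim
        · exact ⟨z, hz.ne', fun w hw => by rcases hw with h | h | h <;> simp [h]⟩
        · exact ⟨y, hy.ne', fun w hw => by rcases hw with h | h | h <;> simp [h]⟩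
        · exact ⟨z, hz.ne', fun w hw => by rcases hw with h | h | h <;> simp [h]⟩
        · exact (hbc rfl).elim
        · exact ⟨x, hx.ne', fun w hw => by rcases hw with h | h | h <;> simp [h]⟩
        · exact ⟨y, hy.ne', fun w hw => by rcases hw with h | h | h <;> simp [h]⟩
        · exact ⟨x, hx.ne', fun w hw => by rcases hw with h | h | h <;> simp [h]⟩
        · exact (hbc rfl).elim
      have hr' : r = p ∨ r = q := hr.imp And.left And.left
      refine hcut r d c hdv (fun w hw => ?_) fun w hw => ?_
      · rcases hd w (hnbr'' r hr' w hw) with rfl | h | h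
        exacts [(h3 hw).elim, Or.inl h, Or.inr h]
      · rcases hnbr c hc w hw with h | h | h
        · exact Or.inr h
        all_goals
          by_cases hwr : w = r
          · exact Or.inl hwr
          · have : w = r' := by
              rcases hr with hr | hr
              · first | exact (hwr (h.trans hr.1.symm)).elim | exact h.trans hr.2.symm
              · first | exact (hwr (h.trans hr.1.symm)).elim | exact h.trans hr.2.symm
            exact (h4 (this ▸ hw.symm)).elim
    obtain ⟨a, ha, b, hb, hab⟩ := hG'.exists_adj_of_mem_of_notMem (A := {v, p, q}) (u := v)
      (v := x) (by simp) (by simp; grind [Adj.ne])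
    have hside : ∀ b, b ∉ ({v, p, q} : Set V) ↔ b = x ∨ b = y ∨ b = z := by
      intro b
      simp only [Set.mem_insert_iff, Set.mem_singleton_iff]
      have := hall b
      grind [Adj.ne]
    have hfrom : ∀ a ∈ ({v, p, q} : Set V), ∀ b ∉ ({v, p, q} : Set V), Gᶜ.Adj a b →
        (a = p ∨ a = q) ∧ (b = x ∨ b = y ∨ b = z) ∧ ¬ G.Adj a b := by
      intro a ha b hb hab
      have hb' := (hside b).1 hb
      rw [compl_adj] at hab
      refine ⟨?_, hb', hab.2⟩
      rcases ha with rfl | ha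
      · rcases hb' with rfl | rfl | rfl
        exacts [(hab.2 hx).elim, (hab.2 hy).elim, (hab.2 hz).elim]
      · simpa using ha
    have hab' := hfrom a ha b hb hab
    refine three_le_md_of_bridge hG' (A := {v, p, q}) (p' := v) (q' := if b = x then y else x)
      ha (by simp) ?_ hb ?_ ?_ fun u hu w hw huw => ?_
    · rcases hab'.1 with rfl | rfl
      exacts [hvp.1, hvp.2.1]
    · rw [hside]
      split_ifs <;> simp
    · split_ifs with h
      · exact h ▸ hxy
      · exact h
    · have huw' := hfrom u hu w hw huw
      by_cases hua : u = a
      · subst hua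
        exact ⟨rfl, by_contra fun hwb => hP u hab'.1 w b huw'.2.1 hab'.2.1 hwb huw'.2.2 hab'.2.2⟩
      exfalso
      by_cases hwb : w = b
      · subst hwb
        have hau : (a = p ∧ u = q) ∨ (a = q ∧ u = p) := by
          rcases hab'.1 with h | h <;> rcases huw'.1 with h' | h'
          exacts [(hua (h'.trans h.symm)).elim, Or.inl ⟨h, h'⟩, Or.inr ⟨h, h'⟩,
            (hua (h'.trans h.symm)).elim]
        have h5 : ¬ G.Adj w a := fun h => hab'.2.2 h.symm
        have h6 : ¬ G.Adj w u := fun h => huw'.2.2 h.symm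
        rcases hau with ⟨h, h'⟩ | ⟨h, h'⟩ <;> rw [h] at h5 <;> rw [h'] at h6
        · exact (hor w hab'.2.1).elim h5 h6
        · exact (hor w hab'.2.1).elim h6 h5
      · exact hR u a w b (by
          rcases hab'.1 with h | h <;> rcases huw'.1 with h' | h'
          exacts [(hua (h'.trans h.symm)).elim, Or.inr ⟨h', h⟩, Or.inl ⟨h', h⟩,
            (hua (h'.trans h.symm)).elim]) huw'.2.1 hab'.2.1 hwb
          huw'.2.2 hab'.2.2

/-- If `G` has a single color, then it has no matching cut and no cut vertex. Either
`three_le_md_compl_of_card_eq_six` applies, or a vertex of degree four is a leaf of the complement.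
In the latter case the complement without this leaf has five vertices and its own complement is
connected, so it has two colors, and the edge at the leaf gets a third one. -/
theorem three_le_md_compl_of_md_lt_two [Fintype V] (hV : Fintype.card V = 6) (hG : G.Connected)
    (hG' : Gᶜ.Connected) (hmd : G.md < 2) : 3 ≤ Gᶜ.md := by
  classical
  have : Nontrivial V := Fintype.one_lt_card_iff_nontrivial.1 (by omega)
  have hM : ∀ A : Set V, ¬ G.IsMatchingCut A := fun A hA =>
    hmd.not_ge (hA.two_le_md hG (by rw [Nat.card_eq_fintype_card]; omega))
  by_cases hD : G.MaxDegreeLEThree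
  · exact three_le_md_compl_of_card_eq_six hV hM hD hG'
  obtain ⟨v, a, b, c, d, hl, ha, hb, hc, hd⟩ : ∃ v a b c d, [a, b, c, d].Nodup ∧ G.Adj v a ∧
      G.Adj v b ∧ G.Adj v c ∧ G.Adj v d := by
    unfold MaxDegreeLEThree at hD
    push Not at hD
    obtain ⟨v, a, b, c, d, hl, ha, hb, hc, hd, -⟩ := hD
    exact ⟨v, a, b, c, d, hl, ha, hb, hc, hd⟩
  obtain ⟨w, hw⟩ := hG'.preconnected.exists_adj_of_nontrivial v
  have hw' := (compl_adj G v w).1 hw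
  have hnd : [v, w, a, b, c, d].Nodup := by grind [Adj.ne]
  have hleaf : ∀ u, Gᶜ.Adj v u → u = w := by
    intro u hu
    rw [compl_adj] at hu
    have := mem_of_nodup_of_length hnd (by simp [hV]) u
    grind
  have hdeg : Gᶜ.degree v = 1 := degree_eq_one_iff_existsUnique_adj.2 ⟨w, hw, hleaf⟩
  have hH := hG'.induce_compl_singleton_of_degree_eq_one hdeg
  have hc : (Gᶜ.induce {v}ᶜ)ᶜ = G.induce {v}ᶜ := by
    ext ⟨x, hx⟩ ⟨y, hy⟩
    simp only [compl_adj, comap_adj, Function.Embedding.subtype_apply, ne_eq, Subtype.mk.injEq]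
    constructor
    · rintro ⟨h1, h2⟩
      tauto
    · intro h
      exact ⟨h.ne, fun h' => h'.2 h⟩
  have hpre : (G.induce {v}ᶜ).Preconnected := by
    by_contra h
    exact hmd.not_ge (two_le_md_of_cutVertex hG h)
  have hcard : Fintype.card ({v}ᶜ : Set V) = 5 := by
    rw [Fintype.card_compl_set, hV, Fintype.card_unique]
  have h2 := two_le_md_of_card_eq_five hcard hH (by
    rw [hc]
    exact { preconnected := hpre, nonempty := hH.nonempty })
  exact (Nat.succ_le_succ h2).trans (md_add_one_le_of_leaf hG' hw hleaf hH)

theorem three_le_md_mul_md_compl_of_card_eq_six [Fintype V] (hV : Fintype.card V = 6)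
    (hG : G.Connected) (hG' : Gᶜ.Connected) : 3 ≤ G.md * Gᶜ.md := by
  have : Nontrivial V := Fintype.one_lt_card_iff_nontrivial.1 (by omega)
  have h1 := one_le_md hG
  have h2 := one_le_md hG'
  by_cases h3 : G.md < 2
  · have := three_le_md_compl_of_md_lt_two hV hG hG' h3
    nlinarith
  by_cases h4 : Gᶜ.md < 2
  · have := three_le_md_compl_of_md_lt_two hV hG' (by rwa [compl_compl]) h4
    rw [compl_compl] at this
    nlinarith
  · nlinarith

/-- A connected graph with four vertices has at least three of the six possible edges, so `G` and
its complement are trees if both are connected. -/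
theorem md_eq_three_of_card_eq_four [Fintype V] (hV : Fintype.card V = 4) (hG : G.Connected)
    (hG' : Gᶜ.Connected) : G.md = 3 ∧ Gᶜ.md = 3 := by
  classical
  have h1 := hG.card_vert_le_card_edgeSet_add_one
  have h2 := hG'.card_vert_le_card_edgeSet_add_one
  have h3 : G.edgeFinset.card + Gᶜ.edgeFinset.card = 6 := by
    have h4 := G.sum_degrees_eq_twice_card_edges
    have h5 := Gᶜ.sum_degrees_eq_twice_card_edges
    have h6 : ∑ v, (G.degree v + Gᶜ.degree v) = ∑ _v : V, 3 := by
      refine Finset.sum_congr rfl fun v _ => ?_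
      have := G.degree_lt_card_verts v
      rw [degree_compl]
      omega
    rw [Finset.sum_add_distrib, Finset.sum_const, Finset.card_univ, hV, smul_eq_mul] at h6
    omega
  rw [Nat.card_eq_fintype_card, Nat.card_eq_fintype_card, ← edgeFinset_card, hV] at h1 h2
  have hT : G.IsTree := isTree_iff_connected_and_card.2 ⟨hG, by
    rw [Nat.card_eq_fintype_card, Nat.card_eq_fintype_card, ← edgeFinset_card, hV]; omega⟩
  have hT' : Gᶜ.IsTree := isTree_iff_connected_and_card.2 ⟨hG', by
    rw [Nat.card_eq_fintype_card, Nat.card_eq_fintype_card, ← edgeFinset_card, hV]; omega⟩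
  have h7 := hT.card_sub_one_le_md
  have h8 := hT'.card_sub_one_le_md
  have h9 := md_le_card_sub_one hG
  have h10 := md_le_card_sub_one hG'
  omega

end Small

/-! ### Extremal graphs -/

/-- A graph is connected if each vertex but the root `r` has a neighbor of smaller rank. -/
theorem connected_of_rank {G : SimpleGraph V} (r : V) (rank : V → ℕ)
    (h : ∀ v, v ≠ r → ∃ w, G.Adj v w ∧ rank w < rank v) : G.Connected := by
  have key : ∀ n v, rank v ≤ n → G.Reachable v r := by
    intro n
    induction n with
    | zero =>
      intro v hv
      by_cases hvr : v = r
      · exact hvr ▸ Reachable.refl _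
      · obtain ⟨w, -, hw⟩ := h v hvr
        omega
    | succ n ih =>
      intro v hv
      by_cases hvr : v = r
      · exact hvr ▸ Reachable.refl _
      · obtain ⟨w, hvw, hw⟩ := h v hvr
        exact hvw.reachable.trans (ih w (by omega))
  exact { preconnected := fun u v => (key _ u le_rfl).trans (key _ v le_rfl).symm
          nonempty := ⟨r⟩ }

/-- The star with center `0` and leaves `1, …, n - 2`, with a further leaf `n - 1` at the
vertex `1`. -/
def broom (n : ℕ) : SimpleGraph (Fin n) :=
  fromRel fun u v => u.val = 0 ∧ v.val + 1 < n ∨ u.val = 1 ∧ v.val + 1 = n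

section Broom

variable {n : ℕ}

theorem broom_adj {u v : Fin n} : (broom n).Adj u v ↔ u.val ≠ v.val ∧
    ((u.val = 0 ∧ v.val + 1 < n ∨ u.val = 1 ∧ v.val + 1 = n) ∨
      (v.val = 0 ∧ u.val + 1 < n ∨ v.val = 1 ∧ u.val + 1 = n)) := by
  rw [broom, fromRel_adj, ne_eq, Fin.ext_iff]

theorem broom_compl_adj {u v : Fin n} : (broom n)ᶜ.Adj u v ↔ u.val ≠ v.val ∧
    ¬ ((u.val = 0 ∧ v.val + 1 < n ∨ u.val = 1 ∧ v.val + 1 = n) ∨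
      (v.val = 0 ∧ u.val + 1 < n ∨ v.val = 1 ∧ u.val + 1 = n)) := by
  rw [compl_adj, broom_adj, ne_eq, Fin.ext_iff]
  exact and_congr_right fun h => not_congr (and_iff_right h)

theorem broom_connected (hn : 4 ≤ n) : (broom n).Connected := by
  refine connected_of_rank ⟨0, by omega⟩
    (fun v => if v.val = 0 then 0 else if v.val + 1 = n then 2 else 1) fun v hv => ?_
  have hv' : v.val ≠ 0 := fun h => hv (Fin.ext h)
  have := v.2
  by_cases h : v.val + 1 = n
  · refine ⟨⟨1, by omega⟩, ?_, ?_⟩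
    · rw [broom_adj]
      dsimp only
      omega
    · dsimp only
      split_ifs <;> omega
  · refine ⟨⟨0, by omega⟩, ?_, by simp [hv', h]⟩
    rw [broom_adj]
    dsimp only
    omega

theorem broom_compl_connected (hn : 4 ≤ n) : (broom n)ᶜ.Connected := by
  refine connected_of_rank ⟨n - 1, by omega⟩
    (fun v => if v.val + 1 = n then 0 else if v.val = 1 then 2 else 1) fun v hv => ?_
  have hv' : v.val + 1 ≠ n := fun h => hv (Fin.ext (by simp; omega))
  have := v.2
  by_cases h : v.val = 1
  · refine ⟨⟨2, by omega⟩, ?_, ?_⟩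
    · rw [broom_compl_adj]
      dsimp only
      omega
    · dsimp only
      split_ifs <;> omega
  · refine ⟨⟨n - 1, by omega⟩, ?_, ?_⟩
    · rw [broom_compl_adj]
      dsimp only
      omega
    · dsimp only
      split_ifs <;> omega

theorem card_sub_one_le_md_broom (hn : 4 ≤ n) : n - 1 ≤ (broom n).md := by
  -- The coordinate `j` belongs to the edge that joins `j + 1` to the rest of the star.
  let f : Fin n → Fin (n - 1) → Prop := fun v j =>
    v.val = j.val + 1 ∨ v.val + 1 = n ∧ j.val = 0
  have hf : (broom n).IsHammingEmbedding f := by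
    refine ⟨fun u v h => ?_, ?_, fun j => ?_⟩
    · have key : ∀ k, k + 1 < n → ((u.val = k + 1 ∨ u.val + 1 = n ∧ k = 0) ↔
          (v.val = k + 1 ∨ v.val + 1 = n ∧ k = 0)) :=
        fun k hk => iff_of_eq (congrFun h ⟨k, by omega⟩)
      have hu := u.2
      have hv := v.2
      have h1 := key (u.val - 1)
      have h2 := key (v.val - 1)
      have h3 := key (n - 2)
      exact Fin.ext (by omega)
    · have key : ∀ u v : Fin n, u.val ≠ v.val →
          (u.val = 0 ∧ v.val + 1 < n ∨ u.val = 1 ∧ v.val + 1 = n) →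
          ∃ i, ∀ j, j ≠ i → f u j = f v j := by
        intro u v huv h
        have := v.2
        refine ⟨⟨v.val - 1, by omega⟩, fun j hj => propext ?_⟩
        rw [ne_eq, Fin.ext_iff] at hj
        dsimp only at hj
        omega
      intro u v huv
      rw [broom_adj] at huv
      rcases huv with ⟨h1, h2 | h2⟩
      · exact key u v h1 h2
      · obtain ⟨i, hi⟩ := key v u (fun h => h1 h.symm) h2
        exact ⟨i, fun j hj => (hi j hj).symm⟩
    · have := j.2
      refine ⟨⟨0, by omega⟩, ⟨j.val + 1, by omega⟩, fun h => ?_⟩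
      have h' : (0 = j.val + 1 ∨ 0 + 1 = n ∧ j.val = 0) ↔
          (j.val + 1 = j.val + 1 ∨ j.val + 1 + 1 = n ∧ j.val = 0) := iff_of_eq h
      omega
  simpa using hf.card_le_md (broom_connected hn)

theorem two_le_md_broom_compl (hn : 4 ≤ n) : 2 ≤ (broom n)ᶜ.md := by
  refine two_le_md_of_leaf (v := ⟨0, by omega⟩) (broom_compl_connected hn) (by simp; omega) ?_
  intro u w hu hw
  rw [broom_compl_adj] at hu hw
  dsimp only at hu hw
  have := u.2
  have := w.2
  exact Fin.ext (by omega)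

end Broom

/-- A graph that has, like its complement, only one color: the complete bipartite graph with
parts `{0, 1}` and `{2, 3, 4, 7, 8, …}`, with a further vertex `5` adjacent to `2` and `4` and a
further vertex `6` adjacent to `2` and `5`. -/
def oneColorGraph (n : ℕ) : SimpleGraph (Fin n) :=
  fromRel fun u v => u.val < 2 ∧ 2 ≤ v.val ∧ v.val ≠ 5 ∧ v.val ≠ 6 ∨
    u.val = 5 ∧ (v.val = 2 ∨ v.val = 4) ∨ u.val = 6 ∧ (v.val = 2 ∨ v.val = 5)

section OneColor

variable {n : ℕ}

theorem oneColorGraph_adj {u v : Fin n} : (oneColorGraph n).Adj u v ↔ u.val ≠ v.val ∧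
    ((u.val < 2 ∧ 2 ≤ v.val ∧ v.val ≠ 5 ∧ v.val ≠ 6 ∨
      u.val = 5 ∧ (v.val = 2 ∨ v.val = 4) ∨ u.val = 6 ∧ (v.val = 2 ∨ v.val = 5)) ∨
    (v.val < 2 ∧ 2 ≤ u.val ∧ u.val ≠ 5 ∧ u.val ≠ 6 ∨
      v.val = 5 ∧ (u.val = 2 ∨ u.val = 4) ∨ v.val = 6 ∧ (u.val = 2 ∨ u.val = 5))) := by
  simp only [oneColorGraph, fromRel_adj, ne_eq, Fin.ext_iff]

theorem oneColorGraph_compl_adj {u v : Fin n} : (oneColorGraph n)ᶜ.Adj u v ↔ u.val ≠ v.val ∧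
    ¬ ((u.val < 2 ∧ 2 ≤ v.val ∧ v.val ≠ 5 ∧ v.val ≠ 6 ∨
      u.val = 5 ∧ (v.val = 2 ∨ v.val = 4) ∨ u.val = 6 ∧ (v.val = 2 ∨ v.val = 5)) ∨
    (v.val < 2 ∧ 2 ≤ u.val ∧ u.val ≠ 5 ∧ u.val ≠ 6 ∨
      v.val = 5 ∧ (u.val = 2 ∨ u.val = 4) ∨ v.val = 6 ∧ (u.val = 2 ∨ u.val = 5))) := by
  rw [compl_adj, oneColorGraph_adj, ne_eq, Fin.ext_iff]
  exact and_congr_right fun h => not_congr (and_iff_right h)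

theorem oneColorGraph_connected (hn : 7 ≤ n) : (oneColorGraph n).Connected := by
  refine connected_of_rank ⟨0, by omega⟩
    (fun v => if v.val = 0 then 0 else if v.val = 1 ∨ v.val = 5 ∨ v.val = 6 then 2 else 1)
    fun v hv => ?_
  have hv' : v.val ≠ 0 := fun h => hv (Fin.ext h)
  by_cases h : v.val = 1 ∨ v.val = 5 ∨ v.val = 6
  · exact ⟨⟨2, by omega⟩, oneColorGraph_adj.2 (by simp; omega), by simp [hv', h]⟩
  · exact ⟨⟨0, by omega⟩, oneColorGraph_adj.2 (by simp; omega), by simp [hv', h]⟩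

theorem oneColorGraph_compl_connected (hn : 7 ≤ n) : (oneColorGraph n)ᶜ.Connected := by
  refine connected_of_rank ⟨3, by omega⟩
    (fun v => if v.val = 3 then 0 else if v.val < 2 then 2 else 1) fun v hv => ?_
  have hv' : v.val ≠ 3 := fun h => hv (Fin.ext h)
  by_cases h : v.val < 2
  · exact ⟨⟨5, by omega⟩, oneColorGraph_compl_adj.2 (by simp; omega), by simp [hv', h]⟩
  · exact ⟨⟨3, by omega⟩, oneColorGraph_compl_adj.2 (by simp; omega), by simp [hv', h]⟩

theorem md_oneColorGraph_le (hn : 7 ≤ n) : (oneColorGraph n).md ≤ 1 := by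
  obtain ⟨ι, _, f, hf, hcard⟩ := exists_isHammingEmbedding (oneColorGraph_connected hn)
  rw [← hcard]
  refine hf.card_le_of_dimLE ?_
  let a : ∀ k, k < 7 → Fin n := fun k hk => ⟨k, by omega⟩
  have h1 : DimLE f {a 0 (by omega), a 1 (by omega)} 1 := by
    refine hf.dimLE_of_three_common (x := a 2 (by omega)) (y := a 3 (by omega))
      (z := a 4 (by omega)) ?_ ?_ ?_ ?_ ?_ ?_ ?_ ?_ ?_ ?_ <;> simp [a, oneColorGraph_adj]
  have h2 := hf.dimLE_union (T := {v | v.val ≠ 5 ∧ v.val ≠ 6}) h1 fun v hv => by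
    by_cases h : v.val < 2
    · left
      simp only [a, Set.mem_insert_iff, Set.mem_singleton_iff, Fin.ext_iff]
      omega
    · refine Or.inr ⟨a 0 (by omega), by simp, a 1 (by omega), by simp, by simp [a], ?_, ?_⟩ <;>
        · rw [oneColorGraph_adj]
          have h1 := hv.1
          have h2 := hv.2
          simp only [a]
          omega
  have h3 := hf.dimLE_insert_two h2 (v := a 5 (by omega)) (s := a 2 (by omega))
    (t := a 4 (by omega)) (by simp [a]) (by simp [a]) (by simp [a])
    (by simp [a, oneColorGraph_adj]) (by simp [a, oneColorGraph_adj])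
  have h4 := hf.dimLE_insert_two h3 (v := a 6 (by omega)) (s := a 2 (by omega))
    (t := a 5 (by omega)) (by simp [a]) (by simp [a]) (by simp [a])
    (by simp [a, oneColorGraph_adj]) (by simp [a, oneColorGraph_adj])
  refine h4.mono (fun v _ => ?_) le_rfl
  by_cases h5 : v = a 5 (by omega)
  · simp [h5]
  by_cases h6 : v = a 6 (by omega)
  · simp [h6]
  · refine Or.inr (Or.inr (Or.inr ?_))
    rw [Fin.ext_iff] at h5 h6
    exact ⟨h5, h6⟩

theorem md_oneColorGraph_compl_le (hn : 7 ≤ n) : (oneColorGraph n)ᶜ.md ≤ 1 := by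
  obtain ⟨ι, _, f, hf, hcard⟩ := exists_isHammingEmbedding (oneColorGraph_compl_connected hn)
  rw [← hcard]
  refine hf.card_le_of_dimLE ?_
  let a : ∀ k, k < 7 → Fin n := fun k hk => ⟨k, by omega⟩
  have h1 : DimLE f {a 0 (by omega), a 1 (by omega), a 5 (by omega)} 1 := by
    refine hf.dimLE_triangle ?_ ?_ ?_ <;> exact oneColorGraph_compl_adj.2 (by simp [a])
  have h2 := hf.dimLE_insert_two h1 (v := a 6 (by omega)) (s := a 0 (by omega))
    (t := a 1 (by omega)) (by simp) (by simp) (by simp [a])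
    (oneColorGraph_compl_adj.2 (by simp [a])) (oneColorGraph_compl_adj.2 (by simp [a]))
  have h3 := hf.dimLE_insert_two h2 (v := a 3 (by omega)) (s := a 5 (by omega))
    (t := a 6 (by omega)) (by simp) (by simp) (by simp [a])
    (oneColorGraph_compl_adj.2 (by simp [a])) (oneColorGraph_compl_adj.2 (by simp [a]))
  have h4 := hf.dimLE_insert_two h3 (v := a 4 (by omega)) (s := a 3 (by omega))
    (t := a 6 (by omega)) (by simp) (by simp) (by simp [a])
    (oneColorGraph_compl_adj.2 (by simp [a])) (oneColorGraph_compl_adj.2 (by simp [a]))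
  refine hf.dimLE_univ h4 fun v => ?_
  by_cases hv : v.val < 7 ∧ v.val ≠ 2
  · left
    simp only [a, Set.mem_insert_iff, Set.mem_singleton_iff, Fin.ext_iff]
    omega
  · refine Or.inr ⟨a 3 (by omega), by simp, a 4 (by omega), by simp, by simp [a], ?_, ?_⟩ <;>
      · rw [oneColorGraph_compl_adj]
        simp only [a]
        omega

end OneColor

/-- Every direction occurs at least twice along a closed walk, so a cycle of length five has at
most two directions. -/
theorem md_le_two_of_cycle_five [Finite V] {G : SimpleGraph V} (hG : G.Connected)
    (a : Fin 5 → V) (ha : Function.Surjective a) (hadj : ∀ i, G.Adj (a i) (a (i + 1))) :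
    G.md ≤ 2 := by
  classical
  obtain ⟨ι, _, f, hf, hcard⟩ := exists_isHammingEmbedding hG
  rw [← hcard]
  choose dir hdir using fun i => hf.adj (hadj i)
  have htwo : ∀ k, 2 ≤ (Finset.univ.filter fun i => dir i = k).card := by
    intro k
    by_contra! h
    obtain ⟨t, ht⟩ : ∃ t, ∀ i, i ≠ t → f (a i) k = f (a (i + 1)) k := by
      rcases (Finset.univ.filter fun i => dir i = k).eq_empty_or_nonempty with h0 | ⟨t, ht⟩
      · refine ⟨0, fun i _ => hdir i k fun hk => ?_⟩
        have : i ∈ Finset.univ.filter fun i => dir i = k := by simp [hk]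
        simp [h0] at this
      · refine ⟨t, fun i hi => hdir i k fun hk => hi ?_⟩
        exact Finset.card_le_one.1 (by omega) i (by simp [hk]) t ht
    have hall : ∀ i, f (a i) k = f (a 0) k := by
      have hcases : ∀ i : Fin 5, i = 0 ∨ i = 1 ∨ i = 2 ∨ i = 3 ∨ i = 4 := by decide
      have h0 : 0 ≠ t → f (a 0) k = f (a 1) k := ht 0
      have h1 : 1 ≠ t → f (a 1) k = f (a 2) k := ht 1
      have h2 : 2 ≠ t → f (a 2) k = f (a 3) k := ht 2
      have h3 : 3 ≠ t → f (a 3) k = f (a 4) k := ht 3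
      have h4 : 4 ≠ t → f (a 4) k = f (a 0) k := ht 4
      intro i
      rcases hcases t with rfl | rfl | rfl | rfl | rfl <;>
        rcases hcases i with rfl | rfl | rfl | rfl | rfl <;> grind
    obtain ⟨u, v, huv⟩ := hf.nonconst k
    obtain ⟨i, rfl⟩ := ha u
    obtain ⟨j, rfl⟩ := ha v
    exact huv ((hall i).trans (hall j).symm)
  have h5 := Finset.card_eq_sum_card_fiberwise (f := dir) (s := Finset.univ) (t := Finset.univ)
    (by simp)
  have h6 := Finset.card_nsmul_le_sum Finset.univ
    (fun k => (Finset.univ.filter fun i => dir i = k).card) 2 fun k _ => htwo k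
  rw [← h5, Finset.card_univ, Finset.card_univ, Fintype.card_fin, smul_eq_mul] at h6
  omega

/-- The cycle with five vertices. -/
def pentagon : SimpleGraph (Fin 5) := fromRel fun u v => v = u + 1

instance : DecidableRel pentagon.Adj := inferInstanceAs (DecidableRel (fromRel _).Adj)

theorem pentagon_connected : pentagon.Connected :=
  connected_of_rank 0 ![0, 1, 2, 2, 1] (by decide)

theorem pentagon_compl_connected : pentagonᶜ.Connected :=
  connected_of_rank 0 ![0, 2, 1, 1, 2] (by decide)

theorem md_pentagon_le : pentagon.md ≤ 2 :=
  md_le_two_of_cycle_five pentagon_connected id Function.surjective_id (by decide)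

theorem md_pentagon_compl_le : pentagonᶜ.md ≤ 2 :=
  md_le_two_of_cycle_five pentagon_compl_connected (fun i => 2 * i) (by decide) (by decide)

/-- The bull: a triangle with leaves at two of its vertices. -/
def bull : SimpleGraph (Fin 5) :=
  fromRel fun u v => (u, v) ∈ [(0, 1), (0, 2), (1, 2), (0, 3), (1, 4)]

instance : DecidableRel bull.Adj := inferInstanceAs (DecidableRel (fromRel _).Adj)

theorem bull_connected : bull.Connected := connected_of_rank 0 ![0, 1, 1, 1, 2] (by decide)

theorem bull_compl_connected : bullᶜ.Connected := connected_of_rank 4 ![1, 2, 1, 1, 0] (by decide)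

theorem three_le_md_bull : 3 ≤ bull.md := by
  have hf : bull.IsHammingEmbedding (![![0, 0, 0], ![1, 0, 0], ![2, 0, 0], ![0, 1, 0], ![1, 0, 1]] :
      Fin 5 → Fin 3 → Fin 3) := ⟨by decide, by decide, by decide⟩
  simpa using hf.card_le_md bull_connected

theorem three_le_md_bull_compl : 3 ≤ bullᶜ.md := by
  have hf : bullᶜ.IsHammingEmbedding (![![1, 1, 0], ![0, 0, 1], ![2, 0, 0], ![0, 0, 0],
      ![1, 0, 0]] : Fin 5 → Fin 3 → Fin 3) := ⟨by decide, by decide, by decide⟩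
  simpa using hf.card_le_md bull_compl_connected

/-- The complete bipartite graph with parts `{0, 1, 2}` and `{3, 4, 5}`, minus the edge between
`0` and `3`. -/
def k33MinusEdge : SimpleGraph (Fin 6) := fromRel fun u v => u < 3 ∧ 3 ≤ v ∧ (u, v) ≠ (0, 3)

instance : DecidableRel k33MinusEdge.Adj := inferInstanceAs (DecidableRel (fromRel _).Adj)

theorem k33MinusEdge_connected : k33MinusEdge.Connected :=
  connected_of_rank 1 ![2, 0, 2, 1, 1, 1] (by decide)

theorem k33MinusEdge_compl_connected : k33MinusEdgeᶜ.Connected :=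
  connected_of_rank 0 ![0, 1, 1, 1, 2, 2] (by decide)

theorem md_k33MinusEdge_le : k33MinusEdge.md ≤ 1 := by
  obtain ⟨ι, _, f, hf, hcard⟩ := exists_isHammingEmbedding k33MinusEdge_connected
  rw [← hcard]
  have h1 : DimLE f {1, 2} 1 := hf.dimLE_of_three_common (x := 3) (y := 4) (z := 5) (by decide)
    (by decide) (by decide) (by decide) (by decide) (by decide) (by decide) (by decide) (by decide)
    (by decide)
  have h2 := hf.dimLE_insert_two h1 (v := 3) (s := 1) (t := 2) (by simp) (by simp) (by decide)
    (by decide) (by decide)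
  have h3 := hf.dimLE_insert_two h2 (v := 4) (s := 1) (t := 2) (by simp) (by simp) (by decide)
    (by decide) (by decide)
  have h4 := hf.dimLE_insert_two h3 (v := 5) (s := 1) (t := 2) (by simp) (by simp) (by decide)
    (by decide) (by decide)
  have h5 := hf.dimLE_insert_two h4 (v := 0) (s := 4) (t := 5) (by simp) (by simp) (by decide)
    (by decide) (by decide)
  refine hf.card_le_of_dimLE (h5.mono (fun v _ => ?_) le_rfl)
  fin_cases v <;> simp

theorem md_k33MinusEdge_compl_le : k33MinusEdgeᶜ.md ≤ 3 := by
  obtain ⟨ι, _, f, hf, hcard⟩ := exists_isHammingEmbedding k33MinusEdge_compl_connected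
  rw [← hcard]
  have h1 : DimLE f {0, 1, 2} 1 := hf.dimLE_triangle (by decide) (by decide) (by decide)
  have h2 := hf.dimLE_insert h1 (v := 3) (s := 0) (by simp) (by decide)
  have h3 := hf.dimLE_insert h2 (v := 4) (s := 3) (by simp) (by decide)
  have h4 := hf.dimLE_insert_two h3 (v := 5) (s := 3) (t := 4) (by simp) (by simp) (by decide)
    (by decide) (by decide)
  refine hf.card_le_of_dimLE (h4.mono (fun v _ => ?_) le_rfl)
  fin_cases v <;> simp

end SimpleGraph

open SimpleGraph

theorem theorem4p4 :
    -- the bounds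
    (∀ (V : Type*) [Fintype V] (G : SimpleGraph V), G.Connected → Gᶜ.Connected →
      (Fintype.card V = 4 → G.md * Gᶜ.md = 9) ∧
      (Fintype.card V = 5 → 4 ≤ G.md * Gᶜ.md ∧ G.md * Gᶜ.md ≤ 9) ∧
      (Fintype.card V = 6 → 3 ≤ G.md * Gᶜ.md ∧ G.md * Gᶜ.md ≤ 10) ∧
      (7 ≤ Fintype.card V →
        1 ≤ G.md * Gᶜ.md ∧ G.md * Gᶜ.md ≤ 2 * (Fintype.card V - 1))) ∧
    -- the bounds are attained, for every order
    (∃ G : SimpleGraph (Fin 4), G.Connected ∧ Gᶜ.Connected ∧ G.md * Gᶜ.md = 9) ∧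
    (∃ G : SimpleGraph (Fin 5), G.Connected ∧ Gᶜ.Connected ∧ G.md * Gᶜ.md = 4) ∧
    (∃ G : SimpleGraph (Fin 5), G.Connected ∧ Gᶜ.Connected ∧ G.md * Gᶜ.md = 9) ∧
    (∃ G : SimpleGraph (Fin 6), G.Connected ∧ Gᶜ.Connected ∧ G.md * Gᶜ.md = 3) ∧
    (∃ G : SimpleGraph (Fin 6), G.Connected ∧ Gᶜ.Connected ∧ G.md * Gᶜ.md = 10) ∧
    (∀ n : ℕ, 7 ≤ n →
      (∃ G : SimpleGraph (Fin n), G.Connected ∧ Gᶜ.Connected ∧ G.md * Gᶜ.md = 1) ∧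
      (∃ G : SimpleGraph (Fin n), G.Connected ∧ Gᶜ.Connected ∧
        G.md * Gᶜ.md = 2 * (n - 1))) := by
  refine ⟨fun V _ G hG hG' => ⟨fun hV => ?_, fun hV => ⟨?_, ?_⟩, fun hV => ⟨?_, ?_⟩,
    fun hV => ⟨?_, ?_⟩⟩, ?_, ?_, ?_, ?_, ?_, fun n hn => ⟨?_, ?_⟩⟩
  · rw [(md_eq_three_of_card_eq_four hV hG hG').1, (md_eq_three_of_card_eq_four hV hG hG').2]
  · exact Nat.mul_le_mul (two_le_md_of_card_eq_five hV hG hG')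
      (two_le_md_of_card_eq_five hV hG' (by rwa [compl_compl]))
  · exact (md_mul_md_compl_le hG hG' hV.ge).trans (by rw [hV]; decide)
  · exact three_le_md_mul_md_compl_of_card_eq_six hV hG hG'
  · exact (md_mul_md_compl_le hG hG' (by omega)).trans (by rw [hV]; decide)
  · have : Nontrivial V := Fintype.one_lt_card_iff_nontrivial.1 (by omega)
    exact Nat.mul_le_mul (one_le_md hG) (one_le_md hG')
  · exact (md_mul_md_compl_le hG hG' (by omega)).trans (max_le (by omega) le_rfl)
  · have h1 := broom_connected (n := 4) le_rfl
    have h2 := broom_compl_connected (n := 4) le_rfl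
    have h3 := md_eq_three_of_card_eq_four (Fintype.card_fin 4) h1 h2
    exact ⟨broom 4, h1, h2, by rw [h3.1, h3.2]⟩
  · have hP := pentagon_connected
    have hP' := pentagon_compl_connected
    exact ⟨pentagon, hP, hP', le_antisymm (Nat.mul_le_mul md_pentagon_le md_pentagon_compl_le)
      (Nat.mul_le_mul (two_le_md_of_card_eq_five (by simp) hP hP')
        (two_le_md_of_card_eq_five (by simp) hP' (by rwa [compl_compl])))⟩
  · refine ⟨bull, bull_connected, bull_compl_connected, le_antisymm ?_
      (Nat.mul_le_mul three_le_md_bull three_le_md_bull_compl)⟩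
    simpa using md_mul_md_compl_le bull_connected bull_compl_connected (by simp)
  · exact ⟨k33MinusEdge, k33MinusEdge_connected, k33MinusEdge_compl_connected, le_antisymm
      (Nat.mul_le_mul md_k33MinusEdge_le md_k33MinusEdge_compl_le)
      (three_le_md_mul_md_compl_of_card_eq_six (by simp) k33MinusEdge_connected
        k33MinusEdge_compl_connected)⟩
  · have h1 := broom_connected (n := 6) (by norm_num)
    have h2 := broom_compl_connected (n := 6) (by norm_num)
    refine ⟨broom 6, h1, h2, le_antisymm ?_ ?_⟩
    · simpa using md_mul_md_compl_le h1 h2 (by simp)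
    · exact Nat.mul_le_mul (card_sub_one_le_md_broom (n := 6) (by norm_num))
        (two_le_md_broom_compl (n := 6) (by norm_num))
  · have : Nontrivial (Fin n) := Fin.nontrivial_iff_two_le.2 (by omega)
    have h1 := oneColorGraph_connected hn
    have h2 := oneColorGraph_compl_connected hn
    exact ⟨oneColorGraph n, h1, h2, le_antisymm
      (Nat.mul_le_mul (md_oneColorGraph_le hn) (md_oneColorGraph_compl_le hn))
      (Nat.mul_le_mul (one_le_md h1) (one_le_md h2))⟩
  · have h4 : 4 ≤ n := by omega
    have h1 := broom_connected h4
    have h2 := broom_compl_connected h4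
    refine ⟨broom n, h1, h2, le_antisymm ?_ ?_⟩
    · refine (md_mul_md_compl_le h1 h2 (by simp; omega)).trans ?_
      rw [Fintype.card_fin]
      exact max_le (by omega) le_rfl
    · rw [mul_comm 2]
      exact Nat.mul_le_mul (card_sub_one_le_md_broom h4) (two_le_md_broom_compl h4)
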